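/- Let $\alpha>-1/2$ and $\sigma>0$. For $\nu>-1$ let $J_\nu$ be the Bessel function of the first kind, and put $\phi_\nu(u)=u^{-\nu}J_\nu(u)$ for $u>0$, $\phi_\nu(0)=\lim_{u\to0^+}\phi_\nu(u)$, and $$\psi_\alpha(u)=\tfrac12\big[\phi_\alpha(|u|)+iu\,\phi_{\alpha+1}(|u|)\big],\qquad dw_\alpha(u)=|u|^{2\alpha+1}du,\qquad u\in\mathbb R.$$ For $x,y\in\mathbb R$ let $$\mathbb W^\alpha_t(x,y)=\int_{\mathbb R}e^{-u^2t}\,\psi_\alpha(xu)\,\overline{\psi_\alpha(yu)}\,dw_\alpha(u)\quad(t>0),\qquad \mathbb H^{\alpha,\sigma}(x,y)=\frac1{\Gamma(\sigma)}\int_0^\infty e^{-t}\,\mathbb W^\alpha_t(x,y)\,t^{\sigma-1}\,dt$$ be the (real-valued) Hankel–Dunkl heat kernel and the Hankel–Dunkl Bessel potential kernel, the latter with values in the extended reals. The following bounds hold uniformly in $x,y\in\mathbb R$. (A) Assume $xy\ge0$. (Ai) If $|x|+|y|\le1$, then $$\mathbb H^{\alpha,\sigma}(x,y)\simeq\chi_{\{\sigma>\alpha+1\}}+\chi_{\{\sigma=\alpha+1\}}\log\frac1{|x|+|y|}+(|x|+|y|)^{-2\alpha-1}\begin{cases}|x-y|^{2\sigma-1},&\sigma<1/2,\\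 \log\frac{2(|x|+|y|)}{|x-y|},&\sigma=1/2,\\(|x|+|y|)^{2\sigma-1},&\sigma>1/2.\end{cases}$$ (Aii) If $|x|+|y|>1$, then $$\mathbb H^{\alpha,\sigma}(x,y)\simeq\simeq(|x|+|y|)^{-2\alpha-1}\exp(-c|x-y|)\begin{cases}|x-y|^{2\sigma-1},&\sigma<1/2,\\1+\log^+\frac1{|x-y|},&\sigma=1/2,\\1,&\sigma>1/2.\end{cases}$$ (B) Assume $xy<0$. (Bi) If $|x|+|y|\le1$, then $$\mathbb H^{\alpha,\sigma}(x,y)\simeq\chi_{\{\sigma>\alpha+1\}}+\chi_{\{\sigma=\alpha+1\}}\log\frac1{|x|+|y|}+(|x|+|y|)^{2\sigma-2\alpha-2}.$$ (Bii) If $|x|+|y|>1$, then $$\mathbb H^{\alpha,\sigma}(x,y)\simeq\simeq(|x|+|y|)^{-2\alpha-1}\exp(-c|x+y|)\,(|x|+|y|)^{-2}.$$ Here $\chi_{\{P\}}$ is $1$ if $P$ holds and $0$ otherwise (a term with factor $0$ is omitted). $X\simeq Y$ means $C^{-1}Y\le X\le CY$ for some constant $C>0$, and $X\simeq\simeq Y\exp(-cZ)$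 means $C^{-1}Y\exp(-c_1Z)\le X\le CY\exp(-c_2Z)$ for some constants $C,c_1,c_2>0$; the constants may depend on $\alpha$ and $\sigma$ but not on $x,y$. The right-hand sides take values in $[0,\infty]$ with the limiting conventions $0^\beta=\infty$ for $\beta<0$ and $\log\frac{a}{0}=\log^+\frac{a}{0}=\infty$ for $a\ge0$; in (Ai) with $\sigma>1/2$ the product of the two powers of $|x|+|y|$ is read as $(|x|+|y|)^{2\sigma-2\alpha-2}$, with $0^0=1$. -/

import Mathlib

open MeasureTheory Set
open scoped ENNReal

namespace HankelDunkl

noncomputable section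

/-- The Bessel function of the first kind `J_ν(u)` of real order `ν > -1`, for `u > 0`,
by its (everywhere absolutely convergent) power series. -/
def besselJ (ν u : ℝ) : ℝ :=
  ∑' k : ℕ, (-1 : ℝ) ^ k / ((k.factorial : ℝ) * Real.Gamma ((k : ℝ) + ν + 1))
    * (u / 2) ^ (2 * (k : ℝ) + ν)

/-- `φ_α(u) = u^{-α} J_α(u)` for `u > 0`; at `u = 0` it is given its limiting value
`1 / (2^α Γ(α+1))`. -/
def phi (α u : ℝ) : ℝ :=
  if u = 0 then 1 / ((2 : ℝ) ^ α * Real.Gamma (α + 1)) else u ^ (-α) * besselJ α u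

/-- The generalized exponential `ψ_α(u) = (φ_α(|u|) + i u φ_{α+1}(|u|)) / 2`, `u ∈ ℝ`. -/
def psi (α u : ℝ) : ℂ :=
  (1 / 2 : ℂ) * ((phi α |u| : ℂ) + Complex.I * (u : ℂ) * (phi (α + 1) |u| : ℂ))

/-- The measure `dw_α(x) = |x|^{2α+1} dx` on `ℝ`. -/
def w (α : ℝ) : Measure ℝ :=
  volume.withDensity fun x => ENNReal.ofReal (|x| ^ (2 * α + 1))

/-- The integral kernel of the Hankel–Dunkl semigroup,
`𝕎_t^α(x,y) = ∫_ℝ e^{-u²t} ψ_α(xu) conj(ψ_α(yu)) dw_α(u)`. -/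
def heatKernel (α t x y : ℝ) : ℂ :=
  ∫ u, (Real.exp (-u ^ 2 * t) : ℂ) * psi α (x * u) * (starRingEnd ℂ) (psi α (y * u)) ∂(w α)

theorem conj_psi (α u : ℝ) : (starRingEnd ℂ) (psi α u) = psi α (-u) := by
  have h2 : (starRingEnd ℂ) 2 = 2 := Complex.conj_ofNat 2
  simp [psi, h2]

/-- The heat kernel is real valued, so that nothing is lost by taking its real part below. -/
theorem heatKernel_im (α t x y : ℝ) : (heatKernel α t x y).im = 0 := by
  rw [← Complex.conj_eq_iff_im, heatKernel, ← integral_conj]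
  have hm : Measurable fun x : ℝ => ENNReal.ofReal (|x| ^ (2 * α + 1)) := by fun_prop
  have hf : ∀ᵐ x : ℝ, ENNReal.ofReal (|x| ^ (2 * α + 1)) < ∞ := by simp
  rw [w, integral_withDensity_eq_integral_toReal_smul hm hf,
    integral_withDensity_eq_integral_toReal_smul hm hf, ← integral_neg_eq_self]
  refine integral_congr_ae (Filter.Eventually.of_forall fun u => ?_)
  simp only [map_mul, Complex.conj_ofReal, conj_psi, abs_neg, neg_sq, mul_neg, neg_neg]

/-- The Bessel potential kernel of the Hankel–Dunkl setting,
`ℍ^{α,σ}(x,y) = Γ(σ)⁻¹ ∫_0^∞ e^{-t} 𝕎_t^α(x,y) t^{σ-1} dt`,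
as an extended-real-valued Lebesgue integral: integral of the positive part minus integral of the
negative part. (Were both infinite, the difference would be `⊥ = -∞` by Mathlib's convention, and
no lower bound by a nonnegative quantity could hold.) -/
def besselKernel (α σ x y : ℝ) : EReal :=
  ((∫⁻ t in Ioi (0 : ℝ), ENNReal.ofReal
      ((Real.Gamma σ)⁻¹ * (Real.exp (-t) * (heatKernel α t x y).re * t ^ (σ - 1))) : ℝ≥0∞) : EReal)
  - ((∫⁻ t in Ioi (0 : ℝ), ENNReal.ofReal
      (-((Real.Gamma σ)⁻¹ * (Real.exp (-t) * (heatKernel α t x y).re * t ^ (σ - 1)))) : ℝ≥0∞) :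
        EReal)

/-- `X ≃ Y` uniformly on `S`: there is a constant `C > 0` with `C⁻¹ Y ≤ X ≤ C Y` on `S`. -/
def Comparable (S : Set (ℝ × ℝ)) (X : ℝ → ℝ → EReal) (Y : ℝ → ℝ → ℝ≥0∞) : Prop :=
  ∃ C : ℝ, 0 < C ∧ ∀ x y : ℝ, (x, y) ∈ S →
    ((ENNReal.ofReal C⁻¹ * Y x y : ℝ≥0∞) : EReal) ≤ X x y ∧
    X x y ≤ ((ENNReal.ofReal C * Y x y : ℝ≥0∞) : EReal)

/-- `X ≃≃ Y exp(-c Z)` uniformly on `S`: there are constants `C, c₁, c₂ > 0` with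
`C⁻¹ Y exp(-c₁ Z) ≤ X ≤ C Y exp(-c₂ Z)` on `S`. -/
def ExpComparable (S : Set (ℝ × ℝ)) (X : ℝ → ℝ → EReal) (Y : ℝ → ℝ → ℝ≥0∞)
    (Z : ℝ → ℝ → ℝ) : Prop :=
  ∃ C c₁ c₂ : ℝ, 0 < C ∧ 0 < c₁ ∧ 0 < c₂ ∧ ∀ x y : ℝ, (x, y) ∈ S →
    ((ENNReal.ofReal C⁻¹ * (Y x y * ENNReal.ofReal (Real.exp (-c₁ * Z x y))) : ℝ≥0∞) : EReal)
      ≤ X x y ∧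
    X x y ≤
      ((ENNReal.ofReal C * (Y x y * ENNReal.ofReal (Real.exp (-c₂ * Z x y))) : ℝ≥0∞) : EReal)

/-- The real power `s^β ∈ [0,∞]` of `s ≥ 0`; in particular `0^β = ∞` for `β < 0`. -/
def epow (s β : ℝ) : ℝ≥0∞ := ENNReal.ofReal s ^ β

/-- `log⁺ (a / b) ∈ [0,∞]` for `a, b ≥ 0`, with the limiting value `∞` when `b = 0`.
It equals `log (a / b)` when `a ≥ b > 0`. -/
def elogRatio (a b : ℝ) : ℝ≥0∞ :=
  if b = 0 then ⊤ else ENNReal.ofReal (Real.posLog (a / b))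

/-- The common part of the local estimates:
`χ_{σ>α+1} + χ_{σ=α+1} log (1/(|x|+|y|))` (used only for `|x|+|y| ≤ 1`). -/
def localCommon (α σ x y : ℝ) : ℝ≥0∞ :=
  (if α + 1 < σ then 1 else 0) + (if σ = α + 1 then elogRatio 1 (|x| + |y|) else 0)

/-- `(|x|+|y|)^{-2α-1}` times `|x-y|^{2σ-1}`, `log (2(|x|+|y|)/|x-y|)` or `(|x|+|y|)^{2σ-1}`
according to `σ < 1/2`, `σ = 1/2` or `σ > 1/2`. In the last case the two powers of `|x|+|y|` are
written as a single one, which gives the product its limiting value in `[0,∞]` at the origin.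
The ratio in the logarithm is at least `2`, so that `log⁺` is `log` there. -/
def sameSignLocal (α σ x y : ℝ) : ℝ≥0∞ :=
  if σ < 1 / 2 then epow (|x| + |y|) (-2 * α - 1) * epow |x - y| (2 * σ - 1)
  else if σ = 1 / 2 then epow (|x| + |y|) (-2 * α - 1) * elogRatio (2 * (|x| + |y|)) |x - y|
  else epow (|x| + |y|) (2 * σ - 2 * α - 2)

/-- `(|x|+|y|)^{-2α-1}` times `|x-y|^{2σ-1}`, `1 + log⁺ (1/|x-y|)` or `1`
according to `σ < 1/2`, `σ = 1/2` or `σ > 1/2`. -/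
def sameSignGlobal (α σ x y : ℝ) : ℝ≥0∞ :=
  epow (|x| + |y|) (-2 * α - 1) *
    (if σ < 1 / 2 then epow |x - y| (2 * σ - 1)
     else if σ = 1 / 2 then 1 + elogRatio 1 |x - y|
     else 1)

end

end HankelDunkl

/-! The heat kernel has a closed form. Weber's second exponential integral, at the orders α and α+1,
gives 𝕎_t(x,y) = (4t)^{-α-1} exp(-(x²+y²)/(4t)) E(xy/(2t)) with E = `dunklExp α`. Weber's formula is
itself an identity of double power series: expanding both Bessel factors and integrating term by
term against the Gaussian leaves coefficients that the Chu–Vandermonde identity resums.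

The size of E follows from a Poisson-type integral over s ∈ (0,1), written in q = 1 - s², by
Laplace's method at q = 0. For z ≥ 0, E(z) is comparable to e^z (1+z)^{-α-1/2}, while E(-z) is
comparable to e^z (1+z)^{-α-3/2}: for negative arguments the amplitude of e^{zs} is (1-s)/2, which
vanishes at s = 1 and costs one power of z.

Put b = |x|+|y|, and a = |x-y| for equal signs, a = |x+y| for opposite signs. Completing the square
turns the bounds for E into Gaussian bounds in a, with the power weight (1+b²/t)^{-α-1/2}
(respectively -α-3/2). So the potential kernel is trapped between multiples of ∫ e^{-t-ca²/t}
t^{σ-3/2} (t+b²)^{-α-1/2} dt, which is `profileIntegral`, with different c on the two sides. The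
case of opposite signs is the same integral with (α,σ) replaced by (α+1,σ+1), so only one integral
has to be estimated.

In that integral the Gaussian cuts off t < a². For a² < t < b² the integrand behaves like b^{-2α-1}
t^{σ-3/2}, with a threshold at σ = 1/2; for b² < t < 1 it behaves like t^{σ-α-2}, with a threshold
at σ = α+1; e^{-t} cuts off t > 1. When b > 1, the exponential decay in a comes from t + ca²/t ≥
2√c·a. Lower bounds come from a single block [r,2r] with r suited to the term in question, or from a
whole logarithmic range at the thresholds. -/

namespace HankelDunkl

/-! ### The Bessel–Clifford series: convergence, measurability, positivity. -/

/-- The Bessel–Clifford function `∑ v^k / (k! Γ(k+ν+1))`, through which Bessel functions and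
modified Bessel functions are expressed simultaneously. -/
noncomputable def clifford (ν v : ℝ) : ℝ :=
  ∑' k : ℕ, v ^ k / ((k.factorial : ℝ) * Real.Gamma ((k : ℝ) + ν + 1))

/-- Each step multiplies by k + a > 1/2. This crude geometric bound suffices to dominate the
Clifford series by an exponential series at 2|v|; it applies with a = ν + 1 exactly when ν > -1/2.
-/
theorem Gamma_lower_geom {a : ℝ} (ha : 1 / 2 < a) (k : ℕ) :
    Real.Gamma a * (1 / 2) ^ k ≤ Real.Gamma ((k : ℝ) + a) := by
  induction k with
  | zero => simp
  | succ k ih =>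
    have hk : (0 : ℝ) ≤ k := Nat.cast_nonneg k
    have h1 : 0 < Real.Gamma a := Real.Gamma_pos_of_pos (by linarith)
    rw [show ((k + 1 : ℕ) : ℝ) + a = ((k : ℝ) + a) + 1 by push_cast; ring,
      Real.Gamma_add_one (by linarith), pow_succ]
    have : 0 < Real.Gamma a * (1 / 2) ^ k := by positivity
    nlinarith

theorem Gamma_nat_add_pos {a : ℝ} (ha : 1 / 2 < a) (k : ℕ) : 0 < Real.Gamma ((k : ℝ) + a) :=
  Real.Gamma_pos_of_pos (by positivity)

theorem summable_clifford_abs {a : ℝ} (ha : 1 / 2 < a) (v : ℝ) :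
    Summable fun k : ℕ => |v| ^ k / ((k.factorial : ℝ) * Real.Gamma ((k : ℝ) + a)) := by
  have h1 : 0 < Real.Gamma a := Real.Gamma_pos_of_pos (by linarith)
  refine Summable.of_nonneg_of_le (fun k => ?_) (fun k => ?_)
    ((Real.summable_pow_div_factorial (2 * |v|)).mul_left (Real.Gamma a)⁻¹)
  · have := Gamma_nat_add_pos ha k
    positivity
  · have h2 := Gamma_lower_geom ha k
    have h3 := Gamma_nat_add_pos ha k
    rw [inv_mul_eq_div, div_div, div_le_div_iff₀ (by positivity) (by positivity), mul_pow]
    have h4 : (0 : ℝ) ≤ |v| ^ k * k.factorial * 2 ^ k := by positivity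
    have h5 : ((1 : ℝ) / 2) ^ k * 2 ^ k = 1 := by rw [← mul_pow]; norm_num
    calc |v| ^ k * (k.factorial * Real.Gamma a)
        = |v| ^ k * k.factorial * 2 ^ k * (Real.Gamma a * (1 / 2) ^ k) := by
          linear_combination (-|v| ^ k * k.factorial * Real.Gamma a) * h5
      _ ≤ |v| ^ k * k.factorial * 2 ^ k * Real.Gamma (k + a) := by gcongr
      _ = _ := by ring

theorem summable_clifford {a : ℝ} (ha : 1 / 2 < a) (v : ℝ) :
    Summable fun k : ℕ => v ^ k / ((k.factorial : ℝ) * Real.Gamma ((k : ℝ) + a)) := by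
  apply Summable.of_norm
  convert summable_clifford_abs ha v using 2 with k
  have := Gamma_nat_add_pos ha k
  rw [norm_div, norm_pow, Real.norm_eq_abs, Real.norm_of_nonneg (by positivity)]

theorem hasSum_clifford {ν : ℝ} (hν : -1 / 2 < ν) (v : ℝ) :
    HasSum (fun k : ℕ => v ^ k / ((k.factorial : ℝ) * Real.Gamma ((k : ℝ) + ν + 1)))
      (clifford ν v) := by
  have := summable_clifford (a := ν + 1) (by linarith) v
  simp only [← add_assoc] at this
  exact this.hasSum

theorem measurable_clifford {ν : ℝ} (hν : -1 / 2 < ν) : Measurable (clifford ν) := by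
  refine measurable_of_tendsto_metrizable (f := fun n v => ∑ k ∈ Finset.range n,
    v ^ k / ((k.factorial : ℝ) * Real.Gamma ((k : ℝ) + ν + 1))) (fun n => by fun_prop) ?_
  exact tendsto_pi_nhds.2 fun v => (hasSum_clifford hν v).tendsto_sum_nat

theorem clifford_pos {ν : ℝ} (hν : -1 / 2 < ν) {v : ℝ} (hv : 0 ≤ v) : 0 < clifford ν v := by
  have h := hasSum_clifford hν v
  have h0 : 0 < Real.Gamma (ν + 1) := Real.Gamma_pos_of_pos (by linarith)
  have := h.summable.le_tsum 0 (fun k _ => by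
    have := Gamma_nat_add_pos (a := ν + 1) (by linarith) k
    rw [← add_assoc] at this
    positivity)
  simp only [pow_zero, Nat.factorial_zero, Nat.cast_one, one_mul, Nat.cast_zero, zero_add] at this
  exact lt_of_lt_of_le (by positivity) this

/-! ### Chu–Vandermonde and the double series behind Weber's formula. -/

/-- Pascal's rule in summed form, the inductive step for Chu–Vandermonde. -/
theorem sum_range_succ_choose_mul (j : ℕ) (f : ℕ → ℝ) :
    ∑ m ∈ Finset.range (j + 2), ((j + 1).choose m : ℝ) * f m =
      ∑ m ∈ Finset.range (j + 1), (j.choose m : ℝ) * f m +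
        ∑ m ∈ Finset.range (j + 1), (j.choose m : ℝ) * f (m + 1) := by
  rw [Finset.sum_range_succ' _ (j + 1)]
  simp only [Nat.choose_succ_succ, Nat.cast_add, add_mul, Finset.sum_add_distrib]
  rw [Finset.sum_range_succ (fun m => (j.choose (m + 1) : ℝ) * f (m + 1)) j,
    Finset.sum_range_succ' (fun m => (j.choose m : ℝ) * f m) j]
  simp
  ring

/-- The Chu–Vandermonde identity, with a real parameter. -/
theorem chu_vandermonde (j : ℕ) : ∀ (k : ℕ) {a : ℝ}, 0 < a →
    ∑ m ∈ Finset.range (j + 1), (j.choose m : ℝ) * ((k.descFactorial m : ℝ) / Real.Gamma (m + a)) =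
      Real.Gamma ((j : ℝ) + k + a) / (Real.Gamma (j + a) * Real.Gamma (k + a)) := by
  induction j with
  | zero =>
    intro k a ha
    have : 0 < Real.Gamma ((k : ℝ) + a) := Real.Gamma_pos_of_pos (by positivity)
    have : 0 < Real.Gamma a := Real.Gamma_pos_of_pos (by positivity)
    simp
    field_simp
  | succ j ih =>
    intro k a ha
    rw [sum_range_succ_choose_mul, ih k ha]
    have hj : 0 < Real.Gamma ((j : ℝ) + a) := Real.Gamma_pos_of_pos (by positivity)
    have hk : 0 < Real.Gamma ((k : ℝ) + a) := Real.Gamma_pos_of_pos (by positivity)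
    have hja : (0 : ℝ) < j + a := by positivity
    have hjka : (0 : ℝ) < j + k + a := by positivity
    have e1 : Real.Gamma (((j + 1 : ℕ) : ℝ) + a) = (j + a) * Real.Gamma (j + a) := by
      rw [← Real.Gamma_add_one hja.ne']; congr 1; push_cast; ring
    have e2 : Real.Gamma (((j + 1 : ℕ) : ℝ) + k + a) = (j + k + a) * Real.Gamma (j + k + a) := by
      rw [← Real.Gamma_add_one hjka.ne']; congr 1; push_cast; ring
    rw [e1, e2]
    cases k with
    | zero =>
      simp
      have : 0 < Real.Gamma a := Real.Gamma_pos_of_pos ha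
      field_simp
    | succ k =>
      -- The second half of Pascal's rule has m + 1 in the falling factorial and in Γ. Extracting
      -- the factor k + 1 lowers k by one, and the shift in Γ raises a by one; hence the induction
      -- must quantify over both k and a.
      have h := ih k (a := a + 1) (by linarith)
      have e3 : ∀ m : ℕ, (j.choose m : ℝ) * (((k + 1).descFactorial (m + 1) : ℝ) /
          Real.Gamma ((m + 1 : ℕ) + a)) = (k + 1) * ((j.choose m : ℝ) *
            ((k.descFactorial m : ℝ) / Real.Gamma (m + (a + 1)))) := by
        intro m
        rw [Nat.succ_descFactorial_succ]
        push_cast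
        rw [show (m : ℝ) + 1 + a = m + (a + 1) by ring]
        ring
      simp only [e3]
      rw [← Finset.mul_sum, h]
      have e4 : Real.Gamma ((j : ℝ) + (a + 1)) = (j + a) * Real.Gamma (j + a) := by
        rw [← Real.Gamma_add_one hja.ne']; congr 1; ring
      have e5 : (k : ℝ) + (a + 1) = ((k + 1 : ℕ) : ℝ) + a := by push_cast; ring
      have e6 : (j : ℝ) + k + (a + 1) = (j : ℝ) + ((k + 1 : ℕ) : ℝ) + a := by push_cast; ring
      rw [e4, e5, e6]
      field_simp
      push_cast
      ring

/-- This is x^m times the m-th derivative of the exponential series. Terms with j < m vanish, and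
for j = i + m the falling factorial cancels against j!. -/
theorem hasSum_descFactorial_exp (x : ℝ) (m : ℕ) :
    HasSum (fun j : ℕ => x ^ j * (j.descFactorial m : ℝ) / (j.factorial : ℝ))
      (x ^ m * Real.exp x) := by
  have h : HasSum (fun i : ℕ => x ^ m * (x ^ i / (i.factorial : ℝ))) (x ^ m * Real.exp x) := by
    rw [Real.exp_eq_exp_ℝ]
    exact (NormedSpace.expSeries_div_hasSum_exp x).mul_left _
  rw [← (add_left_injective m).hasSum_iff]
  · convert h using 2 with i
    simp only [Function.comp]
    have h1 : ((i + m).factorial : ℝ) = (i.factorial : ℝ) * ((i + m).descFactorial m : ℝ) := by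
      have := Nat.factorial_mul_descFactorial (n := i + m) (k := m) (by omega)
      rw [Nat.add_sub_cancel] at this
      exact_mod_cast this.symm
    have h2 : ((i + m).descFactorial m : ℝ) ≠ 0 := by
      have : (i + m).descFactorial m ≠ 0 := by
        rw [Ne, Nat.descFactorial_eq_zero_iff_lt]; omega
      exact_mod_cast this
    have h3 : (i.factorial : ℝ) ≠ 0 := by positivity
    rw [h1, pow_add]
    field_simp
  · intro j hj
    have : j < m := by
      by_contra hh
      exact hj ⟨j - m, by simp; omega⟩
    simp [Nat.descFactorial_eq_zero_iff_lt.2 this]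

/-- The coefficients of the double power series of `e^{x+y} ∑ (xy)^m / (m! Γ(m+a))`. -/
noncomputable def weberCoeff (a : ℝ) (j k : ℕ) : ℝ :=
  Real.Gamma ((j : ℝ) + k + a) /
    (j.factorial * Real.Gamma (j + a) * (k.factorial * Real.Gamma (k + a)))

/-- The terms of the triple series that is summed in two orders to prove Weber's formula. -/
noncomputable def weberTerm (a x y : ℝ) (m j k : ℕ) : ℝ :=
  (x ^ j * (j.descFactorial m : ℝ) / (j.factorial : ℝ)) *
    (y ^ k * (k.descFactorial m : ℝ) / (k.factorial : ℝ)) /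
      ((m.factorial : ℝ) * Real.Gamma (m + a))

/-- The sum is finite, since the falling factorial of j vanishes for m > j, and it is evaluated by
`chu_vandermonde`. -/
theorem hasSum_weberTerm_left {a : ℝ} (ha : 0 < a) (x y : ℝ) (j k : ℕ) :
    HasSum (fun m : ℕ => weberTerm a x y m j k) (weberCoeff a j k * (x ^ j * y ^ k)) := by
  have h := chu_vandermonde j k ha
  have e : weberCoeff a j k * (x ^ j * y ^ k) = ∑ m ∈ Finset.range (j + 1),
      weberTerm a x y m j k := by
    have : weberCoeff a j k * (x ^ j * y ^ k) = (x ^ j / j.factorial) * (y ^ k / k.factorial) *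
        (Real.Gamma ((j : ℝ) + k + a) / (Real.Gamma (j + a) * Real.Gamma (k + a))) := by
      rw [weberCoeff]; ring
    rw [this, ← h, Finset.mul_sum]
    refine Finset.sum_congr rfl fun m _ => ?_
    have h1 : (j.descFactorial m : ℝ) = m.factorial * (j.choose m : ℝ) := by
      exact_mod_cast Nat.descFactorial_eq_factorial_mul_choose j m
    have : (m.factorial : ℝ) ≠ 0 := by positivity
    rw [weberTerm, h1]
    field_simp
  rw [e]
  apply hasSum_sum_of_ne_finset_zero
  intro m hm
  have : j < m := by simpa using hm
  simp [weberTerm, Nat.descFactorial_eq_zero_iff_lt.2 this]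

/-- For fixed m the terms separate in j and k, giving a product of two differentiated exponential
series. -/
theorem hasSum_weberTerm_right (a x y : ℝ) (m : ℕ) :
    HasSum (fun p : ℕ × ℕ => weberTerm a x y m p.1 p.2)
      (Real.exp (x + y) * ((x * y) ^ m / ((m.factorial : ℝ) * Real.Gamma (m + a)))) := by
  have h1 := hasSum_descFactorial_exp x m
  have h2 := hasSum_descFactorial_exp y m
  have h := (h1.mul h2 (summable_mul_of_summable_norm h1.summable.norm h2.summable.norm)).div_const
      ((m.factorial : ℝ) * Real.Gamma (m + a))
  have e : Real.exp (x + y) * ((x * y) ^ m / ((m.factorial : ℝ) * Real.Gamma (m + a))) =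
      x ^ m * Real.exp x * (y ^ m * Real.exp y) / ((m.factorial : ℝ) * Real.Gamma (m + a)) := by
    rw [Real.exp_add, mul_pow]
    ring
  rw [e]
  exact h

theorem norm_weberTerm {a : ℝ} (ha : 1 / 2 < a) (x y : ℝ) (m j k : ℕ) :
    ‖weberTerm a x y m j k‖ = weberTerm a |x| |y| m j k := by
  have := Gamma_nat_add_pos ha m
  simp only [weberTerm, norm_mul, norm_div, norm_pow, Real.norm_eq_abs, Nat.abs_cast,
    abs_of_pos this]

/-- Passing to absolute values replaces x, y by |x|, |y|, so iterated summation of nonnegative terms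
decides: the inner sums are known, and the outer one is a Clifford series. -/
theorem summable_weberTerm {a : ℝ} (ha : 1 / 2 < a) (x y : ℝ) :
    Summable fun q : ℕ × (ℕ × ℕ) => weberTerm a x y q.1 q.2.1 q.2.2 := by
  apply Summable.of_norm
  simp only [norm_weberTerm ha]
  rw [summable_prod_of_nonneg]
  · refine ⟨fun m => (hasSum_weberTerm_right a |x| |y| m).summable, ?_⟩
    simp only [fun m => (hasSum_weberTerm_right a |x| |y| m).tsum_eq]
    exact (summable_clifford ha (|x| * |y|)).mul_left _
  · intro q
    simp only [← norm_weberTerm ha]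
    exact norm_nonneg _

theorem hasSum_weber_series {a : ℝ} (ha : 1 / 2 < a) (x y : ℝ) :
    HasSum (fun p : ℕ × ℕ => weberCoeff a p.1 p.2 * (x ^ p.1 * y ^ p.2))
      (Real.exp (x + y) * ∑' m : ℕ, (x * y) ^ m / ((m.factorial : ℝ) * Real.Gamma (m + a))) := by
  have hsum := summable_weberTerm ha x y
  have hswap : HasSum (fun q : (ℕ × ℕ) × ℕ => weberTerm a x y q.2 q.1.1 q.1.2)
      (∑' q : ℕ × (ℕ × ℕ), weberTerm a x y q.1 q.2.1 q.2.2) :=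
    (Equiv.prodComm (ℕ × ℕ) ℕ).hasSum_iff.2 hsum.hasSum
  have h1 := hswap.prod_fiberwise
    (fun p => hasSum_weberTerm_left (show 0 < a by linarith) x y p.1 p.2)
  have h2 := hsum.hasSum.prod_fiberwise (hasSum_weberTerm_right a x y)
  have h3 := (summable_clifford ha (x * y)).hasSum.mul_left (Real.exp (x + y))
  rw [h3.unique h2]
  exact h1

theorem weberCoeff_pos {a : ℝ} (ha : 1 / 2 < a) (j k : ℕ) : 0 < weberCoeff a j k := by
  have h1 := Gamma_nat_add_pos ha j
  have h2 := Gamma_nat_add_pos ha k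
  have h3 : 0 < Real.Gamma ((j : ℝ) + k + a) := Real.Gamma_pos_of_pos (by positivity)
  rw [weberCoeff]
  positivity

/-! ### Weber's second exponential integral. -/

/-- The integrand of Weber's second exponential integral. -/
noncomputable def weberIntegrand (ν t x y u : ℝ) : ℝ :=
  Real.exp (-u ^ 2 * t) * clifford ν (-(x * u) ^ 2 / 4) * clifford ν (-(y * u) ^ 2 / 4) *
    u ^ (2 * ν + 1)

theorem integral_gaussian_moment {ν t : ℝ} (hν : -1 / 2 < ν) (ht : 0 < t) (n : ℕ) :
    IntegrableOn (fun u : ℝ => Real.exp (-u ^ 2 * t) * (u ^ (2 * n) * u ^ (2 * ν + 1))) (Ioi 0) ∧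
    ∫ u in Ioi (0 : ℝ), Real.exp (-u ^ 2 * t) * (u ^ (2 * n) * u ^ (2 * ν + 1)) =
      Real.Gamma (n + (ν + 1)) / (2 * t ^ (ν + 1)) / t ^ n := by
  have hq : (-1 : ℝ) < 2 * n + 2 * ν + 1 := by
    have : (0 : ℝ) ≤ n := Nat.cast_nonneg n
    linarith
  have e : EqOn (fun u : ℝ => u ^ (2 * (n : ℝ) + 2 * ν + 1) * Real.exp (-t * u ^ (2 : ℝ)))
      (fun u : ℝ => Real.exp (-u ^ 2 * t) * (u ^ (2 * n) * u ^ (2 * ν + 1))) (Ioi 0) := by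
    intro u hu
    have hu : 0 < u := hu
    have h1 : u ^ (2 * (n : ℝ) + 2 * ν + 1) = u ^ (2 * n) * u ^ (2 * ν + 1) := by
      rw [← Real.rpow_natCast, ← Real.rpow_add hu]
      congr 1
      push_cast
      ring
    simp only [h1, Real.rpow_two]
    rw [mul_comm]
    congr 2
    ring
  refine ⟨(integrableOn_rpow_mul_exp_neg_mul_rpow hq two_pos ht).congr_fun e measurableSet_Ioi, ?_⟩
  rw [← setIntegral_congr_fun measurableSet_Ioi e, integral_rpow_mul_exp_neg_mul_rpow two_pos hq ht]
  have h2 : (2 * (n : ℝ) + 2 * ν + 1 + 1) / 2 = n + (ν + 1) := by ring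
  rw [neg_div, h2, Real.rpow_neg ht.le, Real.rpow_add ht, Real.rpow_natCast]
  field_simp

/-- Weber's second exponential integral. -/
theorem integral_weberIntegrand {ν t : ℝ} (hν : -1 / 2 < ν) (ht : 0 < t) (x y : ℝ) :
    ∫ u in Ioi (0 : ℝ), weberIntegrand ν t x y u =
      Real.exp (-(x ^ 2 + y ^ 2) / (4 * t)) * clifford ν ((x * y / (2 * t)) ^ 2 / 4) /
        (2 * t ^ (ν + 1)) := by
  have ha : 1 / 2 < ν + 1 := by linarith
  set X := x ^ 2 / 4 with hX
  set Y := y ^ 2 / 4 with hY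
  set c : ℕ × ℕ → ℝ := fun p => (-X) ^ p.1 * (-Y) ^ p.2 /
    ((p.1.factorial * Real.Gamma (p.1 + (ν + 1))) * (p.2.factorial * Real.Gamma (p.2 + (ν + 1))))
    with hc
  set F : ℕ × ℕ → ℝ → ℝ := fun p u => c p *
    (Real.exp (-u ^ 2 * t) * (u ^ (2 * (p.1 + p.2)) * u ^ (2 * ν + 1))) with hF
  have hint : ∀ p, IntegrableOn (F p) (Ioi 0) := fun p =>
    (integral_gaussian_moment hν ht (p.1 + p.2)).1.const_mul _
  have hval : ∀ p, ∫ u in Ioi (0 : ℝ), F p u = (2 * t ^ (ν + 1))⁻¹ *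
      (weberCoeff (ν + 1) p.1 p.2 * ((-(X / t)) ^ p.1 * (-(Y / t)) ^ p.2)) := by
    intro p
    simp only [hF]
    rw [integral_const_mul, (integral_gaussian_moment hν ht (p.1 + p.2)).2, weberCoeff, hc]
    push_cast
    simp only [neg_pow X, neg_pow Y, neg_pow (X / t), neg_pow (Y / t), div_pow, pow_add]
    field_simp
  -- Each term has the constant sign (-1)^{j+k} on the half-line, so its L¹ norm is the same
  -- expression at X/t, Y/t in place of -X/t, -Y/t. The double series at positive arguments
  -- therefore justifies termwise integration, and at negative arguments it gives the value.
  have hnorm : ∀ p, ∫ u in Ioi (0 : ℝ), ‖F p u‖ = (2 * t ^ (ν + 1))⁻¹ *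
      (weberCoeff (ν + 1) p.1 p.2 * ((X / t) ^ p.1 * (Y / t) ^ p.2)) := by
    intro p
    have h0 := weberCoeff_pos ha p.1 p.2
    have : ∀ u ∈ Ioi (0 : ℝ), ‖F p u‖ = (-1) ^ p.1 * (-1) ^ p.2 * F p u := by
      intro u hu
      have hu : 0 < u := hu
      have h1 := Gamma_nat_add_pos ha p.1
      have h2 := Gamma_nat_add_pos ha p.2
      have hX0 : 0 ≤ X := by positivity
      have hY0 : 0 ≤ Y := by positivity
      have hs : ((-1 : ℝ) ^ p.1 * (-1) ^ p.1) = 1 := by rw [← mul_pow]; norm_num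
      have hs' : ((-1 : ℝ) ^ p.2 * (-1) ^ p.2) = 1 := by rw [← mul_pow]; norm_num
      have h3 : (-1) ^ p.1 * (-1) ^ p.2 * F p u = X ^ p.1 * Y ^ p.2 /
          ((p.1.factorial * Real.Gamma (p.1 + (ν + 1))) *
            (p.2.factorial * Real.Gamma (p.2 + (ν + 1)))) *
          (Real.exp (-u ^ 2 * t) * (u ^ (2 * (p.1 + p.2)) * u ^ (2 * ν + 1))) := by
        simp only [hF, hc, neg_pow X, neg_pow Y]
        linear_combination (X ^ p.1 * Y ^ p.2 /
          ((p.1.factorial * Real.Gamma (p.1 + (ν + 1))) *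
            (p.2.factorial * Real.Gamma (p.2 + (ν + 1)))) *
          (Real.exp (-u ^ 2 * t) * (u ^ (2 * (p.1 + p.2)) * u ^ (2 * ν + 1)))) *
            ((-1 : ℝ) ^ p.2 * (-1) ^ p.2 * hs + hs')
      have h4 : ‖F p u‖ = ‖(-1) ^ p.1 * (-1) ^ p.2 * F p u‖ := by simp
      rw [h4, h3]
      exact Real.norm_of_nonneg (by positivity)
    rw [setIntegral_congr_fun measurableSet_Ioi this, integral_const_mul, hval]
    simp only [neg_pow (X / t), neg_pow (Y / t)]
    have hs : ((-1 : ℝ) ^ p.1 * (-1) ^ p.1) = 1 := by rw [← mul_pow]; norm_num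
    have hs' : ((-1 : ℝ) ^ p.2 * (-1) ^ p.2) = 1 := by rw [← mul_pow]; norm_num
    linear_combination ((2 * t ^ (ν + 1))⁻¹ *
      (weberCoeff (ν + 1) p.1 p.2 * ((X / t) ^ p.1 * (Y / t) ^ p.2))) *
        ((-1 : ℝ) ^ p.2 * (-1) ^ p.2 * hs + hs')
  have hs : Summable fun p => ∫ u in Ioi (0 : ℝ), ‖F p u‖ := by
    simp only [hnorm]
    exact (hasSum_weber_series ha (X / t) (Y / t)).summable.mul_left _
  have h1 := hasSum_integral_of_summable_integral_norm hint hs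
  simp only [hval] at h1
  have h2 := (hasSum_weber_series ha (-(X / t)) (-(Y / t))).mul_left (2 * t ^ (ν + 1))⁻¹
  have h3 := h1.unique h2
  have h4 : ∀ u ∈ Ioi (0 : ℝ), weberIntegrand ν t x y u = ∑' p, F p u := by
    intro u hu
    have hx := hasSum_clifford hν (-(x * u) ^ 2 / 4)
    have hy := hasSum_clifford hν (-(y * u) ^ 2 / 4)
    have := ((hx.mul hy (summable_mul_of_summable_norm hx.summable.norm hy.summable.norm)).mul_left
      (Real.exp (-u ^ 2 * t))).mul_right (u ^ (2 * ν + 1))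
    rw [weberIntegrand, mul_assoc (Real.exp _), ← this.tsum_eq]
    refine tsum_congr fun p => ?_
    have ex : -(x * u) ^ 2 / 4 = (-X) * u ^ 2 := by rw [hX]; ring
    have ey : -(y * u) ^ 2 / 4 = (-Y) * u ^ 2 := by rw [hY]; ring
    simp only [hF, hc]
    rw [ex, ey, mul_pow, mul_pow, add_assoc, add_assoc, mul_add, pow_add, ← pow_mul, ← pow_mul]
    ring
  rw [setIntegral_congr_fun measurableSet_Ioi h4, h3, clifford]
  simp only [← add_assoc]
  have e1 : -(X / t) + -(Y / t) = -(x ^ 2 + y ^ 2) / (4 * t) := by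
    rw [hX, hY]; field_simp
    try ring
  have e2 : -(X / t) * -(Y / t) = (x * y / (2 * t)) ^ 2 / 4 := by
    rw [hX, hY]; field_simp
    try ring
  rw [e1, e2]
  ring

/-- A non-integrable function has integral 0 by convention, whereas the value in Weber's formula is
positive. -/
theorem integrableOn_weberIntegrand {ν t : ℝ} (hν : -1 / 2 < ν) (ht : 0 < t) (x y : ℝ) :
    IntegrableOn (weberIntegrand ν t x y) (Ioi 0) := by
  by_contra h
  have h1 := integral_weberIntegrand hν ht x y
  rw [integral_undef h] at h1
  have h2 := clifford_pos hν (v := (x * y / (2 * t)) ^ 2 / 4) (by positivity)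
  have : 0 < Real.exp (-(x ^ 2 + y ^ 2) / (4 * t)) * clifford ν ((x * y / (2 * t)) ^ 2 / 4) /
        (2 * t ^ (ν + 1)) := by positivity
  linarith

/-! ### The heat kernel in closed form. -/

theorem phi_abs_eq (ν u : ℝ) :
    phi ν |u| = 2 ^ (-ν) * clifford ν (-u ^ 2 / 4) := by
  rw [phi]
  split_ifs with h
  -- Only the term k = 0 survives at the origin, with 0^0 = 1; it agrees with the limiting value
  -- built into `phi`.
  · have hu : u = 0 := abs_eq_zero.1 h
    have h1 : clifford ν (-u ^ 2 / 4) = 1 / Real.Gamma (ν + 1) := by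
      rw [clifford, tsum_eq_single 0 (fun k hk => by simp [hu, hk])]
      simp
    rw [h1, Real.rpow_neg two_pos.le]
    field_simp
  · have hu : 0 < |u| := by positivity
    rw [besselJ, clifford, ← tsum_mul_left, ← tsum_mul_left]
    refine tsum_congr fun k => ?_
    have e1 : (|u| / 2) ^ (2 * (k : ℝ) + ν) = (|u| / 2) ^ (2 * k) * (|u| / 2) ^ ν := by
      rw [Real.rpow_add (by positivity), ← Real.rpow_natCast]
      push_cast
      rfl
    have e2 : (-u ^ 2 / 4) ^ k = (-1) ^ k * (|u| / 2) ^ (2 * k) := by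
      rw [pow_mul, ← mul_pow, div_pow |u|, sq_abs]
      congr 1
      ring
    rw [e1, e2, Real.div_rpow hu.le two_pos.le, Real.rpow_neg hu.le, Real.rpow_neg two_pos.le]
    have : |u| ^ ν ≠ 0 := by positivity
    field_simp

theorem measurable_psi {α : ℝ} (hα : -1 / 2 < α) : Measurable (psi α) := by
  have h1 := measurable_clifford hα
  have h2 := measurable_clifford (ν := α + 1) (by linarith)
  have : psi α = fun u => (1 / 2 : ℂ) * (((2 ^ (-α) * clifford α (-u ^ 2 / 4) : ℝ) : ℂ) +
      Complex.I * (u : ℂ) * ((2 ^ (-(α + 1)) * clifford (α + 1) (-u ^ 2 / 4) : ℝ) : ℂ)) := by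
    ext u
    rw [psi, phi_abs_eq, phi_abs_eq]
  rw [this]
  fun_prop

/-- The real part of the integrand of the heat kernel, extended evenly. -/
noncomputable def evenIntegrand (α t x y s : ℝ) : ℝ :=
  (1 / 4) * (4 ^ (-α) * weberIntegrand α t x y s +
    x * y * 4 ^ (-(α + 1)) * weberIntegrand (α + 1) t x y s)

theorem integrableOn_evenIntegrand {α t : ℝ} (hα : -1 / 2 < α) (ht : 0 < t) (x y : ℝ) :
    IntegrableOn (evenIntegrand α t x y) (Ioi 0) :=
  (((integrableOn_weberIntegrand hα ht x y).const_mul _).add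
    ((integrableOn_weberIntegrand (by linarith) ht x y).const_mul _)).const_mul _

theorem integrable_comp_abs_of_integrableOn_Ioi {f : ℝ → ℝ} (hf : IntegrableOn f (Ioi 0)) :
    Integrable fun x => f |x| := by
  have h1 : IntegrableOn (fun x => f |x|) (Ioi 0) :=
    hf.congr_fun (fun x hx => by rw [abs_of_pos hx]) measurableSet_Ioi
  have h2 : IntegrableOn (fun x => f |x|) (Iic 0) := by
    have := (integrableOn_Ici_iff_integrableOn_Ioi (μ := volume)).2 h1
    have h3 := (neg_zero (G := ℝ)).symm ▸ this
    have h4 := h3.comp_neg_Iic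
    simpa using h4
  rw [← integrableOn_univ, ← Iic_union_Ioi (a := (0 : ℝ))]
  exact h2.union h1

/-- The mixed products of orders α and α+1 are purely imaginary, so the real part keeps only the two
products of equal order. -/
theorem psi_mul_conj_re (α x y u : ℝ) :
    (psi α (x * u) * (starRingEnd ℂ) (psi α (y * u))).re =
      (1 / 4) * (4 ^ (-α) * (clifford α (-(x * u) ^ 2 / 4) * clifford α (-(y * u) ^ 2 / 4)) +
        x * y * 4 ^ (-(α + 1)) * u ^ 2 *
          (clifford (α + 1) (-(x * u) ^ 2 / 4) * clifford (α + 1) (-(y * u) ^ 2 / 4))) := by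
  have e (b : ℝ) : (4 : ℝ) ^ b = 2 ^ b * 2 ^ b := by
    rw [← Real.mul_rpow two_pos.le two_pos.le]; norm_num
  rw [conj_psi]
  simp only [psi, abs_neg, phi_abs_eq, e]
  simp
  ring

theorem rpow_abs_mul_sq {α u : ℝ} (hα : -1 / 2 < α) :
    |u| ^ (2 * α + 1) * u ^ 2 = |u| ^ (2 * (α + 1) + 1) := by
  rcases eq_or_ne u 0 with rfl | hu
  -- Here α > -1/2 matters: 2α+1 > 0, so both sides vanish at the origin.
  · rw [abs_zero, Real.zero_rpow (by linarith), Real.zero_rpow (by linarith)]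
    simp
  · have : 0 < |u| := by positivity
    rw [← sq_abs, ← Real.rpow_two, ← Real.rpow_add this]
    congr 1
    ring

theorem weight_mul_integrand_re {α : ℝ} (hα : -1 / 2 < α) (t x y u : ℝ) :
    |u| ^ (2 * α + 1) * (Real.exp (-u ^ 2 * t) *
      (psi α (x * u) * (starRingEnd ℂ) (psi α (y * u))).re) = evenIntegrand α t x y |u| := by
  rw [psi_mul_conj_re, evenIntegrand, weberIntegrand, weberIntegrand, ← rpow_abs_mul_sq hα]
  simp only [mul_pow, sq_abs]
  ring

theorem integral_w (α : ℝ) (f : ℝ → ℂ) :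
    ∫ u, f u ∂(w α) = ∫ u : ℝ, (|u| ^ (2 * α + 1)) • f u := by
  have hm : Measurable fun x : ℝ => ENNReal.ofReal (|x| ^ (2 * α + 1)) := by fun_prop
  have hf : ∀ᵐ x : ℝ, ENNReal.ofReal (|x| ^ (2 * α + 1)) < ∞ := by simp
  rw [w, integral_withDensity_eq_integral_toReal_smul hm hf]
  refine integral_congr_ae (Filter.Eventually.of_forall fun u => ?_)
  simp only
  rw [ENNReal.toReal_ofReal (by positivity)]

/-- The inequality |ψ(xu)ψ(yu)| ≤ |ψ(xu)|² + |ψ(yu)|² reduces the claim to the diagonal cases (x,x)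
and (y,y), where the integrand is real and Weber's integral gives integrability. -/
theorem integrable_heat_integrand {α t : ℝ} (hα : -1 / 2 < α) (ht : 0 < t) (x y : ℝ) :
    Integrable fun u : ℝ => (|u| ^ (2 * α + 1)) •
      ((Real.exp (-u ^ 2 * t) : ℂ) * psi α (x * u) * (starRingEnd ℂ) (psi α (y * u))) := by
  have hm := measurable_psi hα
  have hx := integrable_comp_abs_of_integrableOn_Ioi (integrableOn_evenIntegrand hα ht x x)
  have hy := integrable_comp_abs_of_integrableOn_Ioi (integrableOn_evenIntegrand hα ht y y)
  refine Integrable.mono' (hx.add hy) ?_ (Filter.Eventually.of_forall fun u => ?_)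
  · have : Measurable fun u : ℝ => (|u| ^ (2 * α + 1)) • ((Real.exp (-u ^ 2 * t) : ℂ) *
        psi α (x * u) * (starRingEnd ℂ) (psi α (y * u))) := by
      simp only [conj_psi]
      fun_prop
    exact this.aestronglyMeasurable
  · simp only [Pi.add_apply]
    rw [← weight_mul_integrand_re hα, ← weight_mul_integrand_re hα, Complex.mul_conj,
      Complex.mul_conj, Complex.ofReal_re, Complex.ofReal_re, Complex.normSq_eq_norm_sq,
      Complex.normSq_eq_norm_sq, norm_smul, norm_mul, norm_mul, RCLike.norm_conj, ← mul_add,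
      ← mul_add, mul_assoc, Real.norm_of_nonneg (by positivity), Complex.norm_real,
      Real.norm_of_nonneg (Real.exp_nonneg _)]
    gcongr
    nlinarith [sq_nonneg (‖psi α (x * u)‖ - ‖psi α (y * u)‖), sq_nonneg ‖psi α (x * u)‖,
      sq_nonneg ‖psi α (y * u)‖]

/-- The profile of the heat kernel, a multiple of the Dunkl exponential. -/
noncomputable def dunklExp (α Z : ℝ) : ℝ :=
  clifford α (Z ^ 2 / 4) + Z / 2 * clifford (α + 1) (Z ^ 2 / 4)

/-- The real part is even in u, so it is twice a half-line integral, to which Weber's formula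
applies at the orders α and α+1. The extra factor xy/t at order α+1 becomes the factor Z/2 in
`dunklExp`. -/
theorem heatKernel_re {α t : ℝ} (hα : -1 / 2 < α) (ht : 0 < t) (x y : ℝ) :
    (heatKernel α t x y).re = 4 ^ (-(α + 1)) * t ^ (-(α + 1)) *
      Real.exp (-(x ^ 2 + y ^ 2) / (4 * t)) * dunklExp α (x * y / (2 * t)) := by
  have h1 : (heatKernel α t x y).re = ∫ u : ℝ, evenIntegrand α t x y |u| := by
    rw [heatKernel, integral_w]
    have := integral_re (𝕜 := ℂ) (integrable_heat_integrand hα ht x y)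
    simp only [RCLike.re_to_complex] at this
    rw [← this]
    refine integral_congr_ae (Filter.Eventually.of_forall fun u => ?_)
    simp only
    rw [← weight_mul_integrand_re hα, mul_assoc, Complex.smul_re, Complex.re_ofReal_mul, smul_eq_mul]
  rw [h1, integral_comp_abs]
  simp only [evenIntegrand]
  rw [integral_const_mul, integral_add ((integrableOn_weberIntegrand hα ht x y).const_mul _)
    ((integrableOn_weberIntegrand (by linarith) ht x y).const_mul _), integral_const_mul,
    integral_const_mul, integral_weberIntegrand hα ht, integral_weberIntegrand (by linarith) ht,
    dunklExp, Real.rpow_neg ht.le, Real.rpow_add_one ht.ne' (α + 1), neg_add α 1,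
    Real.rpow_add four_pos, Real.rpow_neg_one]
  have : t ^ (α + 1) ≠ 0 := by positivity
  field_simp
  ring

/-! ### Beta integrals and the Poisson-type representation. -/

theorem hasSum_of_forall_eq {f g : ℕ → ℝ} {S : ℝ} (e : ∀ m, f m = g m) (h : HasSum g S) :
    HasSum f S := by
  rwa [funext e]

theorem integral_beta {a b : ℝ} (ha : 0 < a) (hb : 0 < b) :
    ∫ q in Ioo (0 : ℝ) 1, q ^ (a - 1) * (1 - q) ^ (b - 1) =
      Real.Gamma a * Real.Gamma b / Real.Gamma (a + b) := by
  have h1 := ProbabilityTheory.lintegral_betaPDF_eq_one ha hb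
  rw [ProbabilityTheory.lintegral_betaPDF] at h1
  have hB := ProbabilityTheory.beta_pos ha hb
  have h2 := integral_eq_lintegral_of_nonneg_ae (μ := volume.restrict (Ioo (0 : ℝ) 1))
    (f := fun x => 1 / ProbabilityTheory.beta a b * x ^ (a - 1) * (1 - x) ^ (b - 1))
    (ae_restrict_of_forall_mem measurableSet_Ioo fun x hx => by
      have := hx.1
      have := sub_pos.2 hx.2
      simp only [Pi.zero_apply]
      positivity) (by fun_prop)
  rw [h1] at h2
  simp only [mul_assoc] at h2
  rw [integral_const_mul] at h2
  rw [← ProbabilityTheory.beta]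
  field_simp at h2
  simpa using h2

theorem integrableOn_beta {a b : ℝ} (ha : 0 < a) (hb : 0 < b) :
    IntegrableOn (fun q : ℝ => q ^ (a - 1) * (1 - q) ^ (b - 1)) (Ioo 0 1) := by
  by_contra h
  have h1 := integral_beta ha hb
  rw [integral_undef h] at h1
  have := ProbabilityTheory.beta_pos ha hb
  rw [ProbabilityTheory.beta, ← h1] at this
  exact lt_irrefl _ this

/-- Since each g n is nonnegative, the L¹ norm of c n * g n is |c n| ∫ g n. Summability of the
integrated series in ℝ is absolute, so it already licenses the interchange. -/
theorem hasSum_integral_const_mul {μ : Measure ℝ} {c : ℕ → ℝ} {g : ℕ → ℝ → ℝ} {f : ℝ → ℝ}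
    {S : ℝ} (hg : ∀ n, Integrable (g n) μ) (hpos : ∀ n, ∀ᵐ x ∂μ, 0 ≤ g n x)
    (hf : ∀ᵐ x ∂μ, HasSum (fun n => c n * g n x) (f x))
    (hS : HasSum (fun n => c n * ∫ x, g n x ∂μ) S) : ∫ x, f x ∂μ = S := by
  have h1 := hasSum_integral_of_summable_integral_norm (μ := μ) (F := fun n x => c n * g n x)
    (fun n => (hg n).const_mul _) (by
      convert hS.summable.norm using 2 with n
      simp only [norm_mul]
      rw [integral_const_mul, Real.norm_of_nonneg (integral_nonneg_of_ae (hpos n))]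
      congr 1
      exact integral_congr_ae ((hpos n).mono fun x hx => Real.norm_of_nonneg hx))
  simp only [integral_const_mul] at h1
  rw [hS.unique h1]
  exact integral_congr_ae (hf.mono fun x hx => hx.tsum_eq.symm)

theorem Gamma_nat_add_half_mul (m : ℕ) :
    Real.Gamma (m + 1 / 2) * (4 ^ m * m.factorial) = (2 * m).factorial * √Real.pi := by
  induction m with
  | zero => simpa using Real.Gamma_one_half_eq
  | succ m ih =>
    have e : Real.Gamma ((m + 1 : ℕ) + 1 / 2) = (m + 1 / 2) * Real.Gamma (m + 1 / 2) := by
      rw [← Real.Gamma_add_one (by positivity)]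
      congr 1
      push_cast
      ring
    rw [e, show 2 * (m + 1) = 2 * m + 1 + 1 by ring, Nat.factorial_succ, Nat.factorial_succ,
      Nat.factorial_succ]
    push_cast
    linear_combination (m + 1 / 2) * 4 * (m + 1) * ih

/-- The integrand of the Poisson-type representation of `dunklExp`, in the variable `q = 1 - s²`. -/
noncomputable def poissonIntegrand (α Z q : ℝ) : ℝ :=
  (Real.cosh (Z * √(1 - q)) + √(1 - q) * Real.sinh (Z * √(1 - q))) *
    (q ^ (α + 1 / 2 - 1) * (1 - q) ^ ((1 : ℝ) / 2 - 1))

/-- Expand cosh in powers of s = √(1-q). Only even powers of s occur, so each term is a Beta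
integral B(α+1/2, m+1/2), and the value of Γ(m+1/2) turns (2m)! into 4^m m!. -/
theorem integral_cosh_poisson {α : ℝ} (hα : -1 / 2 < α) (Z : ℝ) :
    ∫ q in Ioo (0 : ℝ) 1, Real.cosh (Z * √(1 - q)) *
        (q ^ (α + 1 / 2 - 1) * (1 - q) ^ ((1 : ℝ) / 2 - 1)) =
      √Real.pi * Real.Gamma (α + 1 / 2) * clifford α (Z ^ 2 / 4) := by
  have ha : 0 < α + 1 / 2 := by linarith
  have hb (m : ℕ) : (0 : ℝ) < m + 1 / 2 := by positivity
  refine hasSum_integral_const_mul (c := fun m : ℕ => Z ^ (2 * m) / (2 * m).factorial)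
    (g := fun m q => q ^ (α + 1 / 2 - 1) * (1 - q) ^ ((m : ℝ) + 1 / 2 - 1))
    (fun m => integrableOn_beta ha (hb m))
    (fun m => ae_restrict_of_forall_mem measurableSet_Ioo fun q hq => ?_)
    (ae_restrict_of_forall_mem measurableSet_Ioo fun q hq => ?_) ?_
  · have := hq.1
    have := sub_pos.2 hq.2
    positivity
  · have h0 := sub_pos.2 hq.2
    refine hasSum_of_forall_eq (fun m => ?_) ((Real.hasSum_cosh (Z * √(1 - q))).mul_right
      (q ^ (α + 1 / 2 - 1) * (1 - q) ^ ((1 : ℝ) / 2 - 1)))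
    rw [mul_pow, pow_mul √(1 - q), Real.sq_sqrt h0.le, add_sub_assoc (m : ℝ), Real.rpow_add h0,
      Real.rpow_natCast]
    ring
  · refine hasSum_of_forall_eq (fun m => ?_)
      ((hasSum_clifford hα (Z ^ 2 / 4)).mul_left (√Real.pi * Real.Gamma (α + 1 / 2)))
    rw [integral_beta ha (hb m)]
    have h1 := Gamma_nat_add_half_mul m
    have h2 : Real.Gamma (m + 1 / 2) = (2 * m).factorial * √Real.pi / (4 ^ m * m.factorial) := by
      rw [← h1]; field_simp
    have h3 := Gamma_nat_add_pos (a := α + 1) (by linarith) m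
    rw [h2, show α + 1 / 2 + (m + 1 / 2) = m + (α + 1) by ring, add_assoc, div_pow, pow_mul]
    field_simp

/-- As for cosh: the prefactor √(1-q) makes the odd powers of √(1-q) even, and the Beta parameter
m+3/2 produces order α+1. -/
theorem integral_sinh_poisson {α : ℝ} (hα : -1 / 2 < α) (Z : ℝ) :
    ∫ q in Ioo (0 : ℝ) 1, √(1 - q) * Real.sinh (Z * √(1 - q)) *
        (q ^ (α + 1 / 2 - 1) * (1 - q) ^ ((1 : ℝ) / 2 - 1)) =
      √Real.pi * Real.Gamma (α + 1 / 2) * (Z / 2 * clifford (α + 1) (Z ^ 2 / 4)) := by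
  have ha : 0 < α + 1 / 2 := by linarith
  have hb (m : ℕ) : (0 : ℝ) < (m + 1 : ℕ) + 1 / 2 := by positivity
  refine hasSum_integral_const_mul (c := fun m : ℕ => Z ^ (2 * m + 1) / (2 * m + 1).factorial)
    (g := fun m q => q ^ (α + 1 / 2 - 1) * (1 - q) ^ (((m + 1 : ℕ) : ℝ) + 1 / 2 - 1))
    (fun m => integrableOn_beta ha (hb m))
    (fun m => ae_restrict_of_forall_mem measurableSet_Ioo fun q hq => ?_)
    (ae_restrict_of_forall_mem measurableSet_Ioo fun q hq => ?_) ?_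
  · have := hq.1
    have := sub_pos.2 hq.2
    positivity
  · have h0 := sub_pos.2 hq.2
    refine hasSum_of_forall_eq (fun m => ?_)
      (((Real.hasSum_sinh (Z * √(1 - q))).mul_left √(1 - q)).mul_right
        (q ^ (α + 1 / 2 - 1) * (1 - q) ^ ((1 : ℝ) / 2 - 1)))
    have e : √(1 - q) * √(1 - q) ^ (2 * m + 1) = (1 - q) ^ (m + 1) := by
      rw [← pow_succ', show 2 * m + 1 + 1 = 2 * (m + 1) by ring, pow_mul, Real.sq_sqrt h0.le]
    rw [mul_pow, add_sub_assoc ((m + 1 : ℕ) : ℝ), Real.rpow_add h0, Real.rpow_natCast, ← e]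
    ring
  · refine hasSum_of_forall_eq (fun m => ?_)
      (((hasSum_clifford (ν := α + 1) (by linarith) (Z ^ 2 / 4)).mul_left (Z / 2)).mul_left
        (√Real.pi * Real.Gamma (α + 1 / 2)))
    rw [integral_beta ha (hb m)]
    have h1 := Gamma_nat_add_half_mul (m + 1)
    have h2 : Real.Gamma ((m + 1 : ℕ) + 1 / 2) =
        (2 * (m + 1)).factorial * √Real.pi / (4 ^ (m + 1) * (m + 1).factorial) := by
      rw [← h1]; field_simp
    have h3 := Gamma_nat_add_pos (a := α + 2) (by linarith) m
    rw [h2, show α + 1 / 2 + ((m + 1 : ℕ) + 1 / 2) = m + (α + 2) by push_cast; ring,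
      show (m : ℝ) + (α + 1) + 1 = m + (α + 2) by ring, div_pow, ← pow_mul,
      show 2 * (m + 1) = 2 * m + 1 + 1 by ring, Nat.factorial_succ (2 * m + 1),
      Nat.factorial_succ m]
    push_cast
    field_simp
    ring

theorem integrableOn_poissonIntegrand {α : ℝ} (hα : -1 / 2 < α) (Z : ℝ) :
    IntegrableOn (fun q => Real.cosh (Z * √(1 - q)) *
        (q ^ (α + 1 / 2 - 1) * (1 - q) ^ ((1 : ℝ) / 2 - 1))) (Ioo 0 1) ∧
      IntegrableOn (fun q => √(1 - q) * Real.sinh (Z * √(1 - q)) *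
        (q ^ (α + 1 / 2 - 1) * (1 - q) ^ ((1 : ℝ) / 2 - 1))) (Ioo 0 1) := by
  have hI := (integrableOn_beta (a := α + 1 / 2) (b := 1 / 2) (by linarith) (by norm_num)).const_mul
    (Real.exp |Z|)
  have key : ∀ q ∈ Ioo (0 : ℝ) 1, |Z * √(1 - q)| ≤ |Z| ∧ √(1 - q) ≤ 1 := fun q hq => by
    have : √(1 - q) ≤ 1 := Real.sqrt_le_one.2 (by linarith [hq.1])
    rw [abs_mul, abs_of_nonneg (Real.sqrt_nonneg _)]
    exact ⟨mul_le_of_le_one_right (abs_nonneg _) this, this⟩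
  have hc : ∀ v : ℝ, Real.cosh v ≤ Real.exp |v| := fun v => by
    rw [← Real.cosh_abs, Real.cosh_eq]
    have : Real.exp (-|v|) ≤ Real.exp |v| := Real.exp_le_exp.2 (by linarith [abs_nonneg v])
    linarith
  have hs : ∀ v : ℝ, |Real.sinh v| ≤ Real.exp |v| := fun v =>
    le_trans (abs_le.2 ⟨by have := Real.cosh_add_sinh v; linarith [Real.exp_pos v],
      (Real.sinh_lt_cosh v).le⟩) (hc v)
  constructor
  · refine Integrable.mono' hI (by fun_prop) (ae_restrict_of_forall_mem measurableSet_Ioo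
      fun q hq => ?_)
    have h0 := sub_pos.2 hq.2
    have h1 := hq.1
    rw [Real.norm_of_nonneg (by have := Real.cosh_pos (Z * √(1 - q)); positivity)]
    gcongr
    exact (hc _).trans (Real.exp_le_exp.2 (key q hq).1)
  · refine Integrable.mono' hI (by fun_prop) (ae_restrict_of_forall_mem measurableSet_Ioo
      fun q hq => ?_)
    have h0 := sub_pos.2 hq.2
    have h1 := hq.1
    rw [norm_mul, norm_mul, Real.norm_of_nonneg (Real.sqrt_nonneg _), Real.norm_eq_abs (Real.sinh _),
      Real.norm_of_nonneg (show 0 ≤ q ^ (α + 1 / 2 - 1) * (1 - q) ^ ((1 : ℝ) / 2 - 1) by positivity)]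
    gcongr
    calc √(1 - q) * |Real.sinh (Z * √(1 - q))| ≤ 1 * |Real.sinh (Z * √(1 - q))| := by
          gcongr; exact (key q hq).2
      _ ≤ _ := by
        rw [one_mul]
        exact (hs _).trans (Real.exp_le_exp.2 (key q hq).1)

/-- A Poisson-type integral representation of the Dunkl exponential. -/
theorem integral_poissonIntegrand {α : ℝ} (hα : -1 / 2 < α) (Z : ℝ) :
    ∫ q in Ioo (0 : ℝ) 1, poissonIntegrand α Z q =
      √Real.pi * Real.Gamma (α + 1 / 2) * dunklExp α Z := by
  simp only [poissonIntegrand, add_mul]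
  rw [integral_add (integrableOn_poissonIntegrand hα Z).1 (integrableOn_poissonIntegrand hα Z).2,
    integral_cosh_poisson hα, integral_sinh_poisson hα, dunklExp]
  ring

/-! ### Two-sided bounds for the Dunkl exponential. -/

theorem exists_one_add_rpow_le_exp (p : ℝ) {ε : ℝ} (hε : 0 < ε) :
    ∃ C : ℝ, 0 < C ∧ ∀ x : ℝ, 0 ≤ x → (1 + x) ^ p ≤ C * Real.exp (ε * x) := by
  -- With K ≥ 1 one has 1 + x ≤ K e^{x/K}; raising this to the power |p| costs e^{|p|x/K}, and |p|/K
  -- ≤ ε.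
  set K := max 1 (|p| / ε) with hK
  have hK1 : 1 ≤ K := le_max_left _ _
  have hK2 : |p| ≤ K * ε := by
    have : |p| / ε ≤ K := le_max_right _ _
    rwa [div_le_iff₀ hε] at this
  refine ⟨K ^ |p|, by positivity, fun x hx => ?_⟩
  have h1 : 1 + x ≤ K * Real.exp (x / K) := by
    have := Real.add_one_le_exp (x / K)
    calc 1 + x ≤ K * (x / K + 1) := by
          rw [mul_add, mul_div_cancel₀ _ (by positivity)]; linarith
      _ ≤ _ := by gcongr
  calc (1 + x) ^ p ≤ (1 + x) ^ |p| :=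
        Real.rpow_le_rpow_of_exponent_le (by linarith) (le_abs_self p)
    _ ≤ (K * Real.exp (x / K)) ^ |p| := by gcongr
    _ = K ^ |p| * Real.exp (x / K * |p|) := by
      rw [Real.mul_rpow (by positivity) (by positivity), ← Real.exp_mul]
    _ ≤ K ^ |p| * Real.exp (ε * x) := by
      refine mul_le_mul_of_nonneg_left (Real.exp_le_exp.2 ?_) (by positivity)
      rw [div_mul_eq_mul_div, div_le_iff₀ (by positivity)]
      nlinarith

/-- The Laplace-type integral governing `dunklExp`. -/
noncomputable def laplaceBeta (p z : ℝ) : ℝ :=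
  ∫ q in Ioo (0 : ℝ) 1, Real.exp (-z * q) * (q ^ (p - 1) * (1 - q) ^ ((1 : ℝ) / 2 - 1))

theorem integrableOn_laplaceBeta {p z : ℝ} (hp : 0 < p) (hz : 0 ≤ z) :
    IntegrableOn (fun q => Real.exp (-z * q) * (q ^ (p - 1) * (1 - q) ^ ((1 : ℝ) / 2 - 1)))
      (Ioo 0 1) := by
  refine Integrable.mono' (integrableOn_beta (a := p) (b := 1 / 2) hp (by norm_num)) (by fun_prop)
    (ae_restrict_of_forall_mem measurableSet_Ioo fun q hq => ?_)
  have h0 := sub_pos.2 hq.2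
  have h1 := hq.1
  rw [Real.norm_of_nonneg (by positivity)]
  refine mul_le_of_le_one_left (by positivity) (Real.exp_le_one_iff.2 ?_)
  rw [neg_mul]
  exact neg_nonpos.2 (by positivity)

/-- Split at q = 1/2. Below, (1-q)^{-1/2} ≤ √2, and replacing z by z+1 in the exponential costs only
a factor e while the resulting Gamma integral is finite even at z = 0. Above, e^{-zq} ≤ e^{-z/2},
which beats (1+z)^{-p}. -/
theorem exists_laplaceBeta_le {p : ℝ} (hp : 0 < p) :
    ∃ C : ℝ, 0 < C ∧ ∀ z : ℝ, 0 ≤ z → laplaceBeta p z ≤ C * (1 + z) ^ (-p) := by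
  obtain ⟨C₀, hC₀, hC⟩ := exists_one_add_rpow_le_exp p (ε := 1 / 2) (by norm_num)
  set B := Real.Gamma p * Real.Gamma (1 / 2) / Real.Gamma (p + 1 / 2) with hB
  have hG := Real.Gamma_pos_of_pos hp
  have hBpos : 0 < B := ProbabilityTheory.beta_pos hp (by norm_num)
  refine ⟨√2 * (Real.exp 1 * Real.Gamma p) + C₀ * B, by positivity, fun z hz => ?_⟩
  have i1 : IntegrableOn (fun q : ℝ => q ^ (p - 1) * Real.exp (-((z + 1) * q))) (Ioi 0) := by
    by_contra h
    have h1 := Real.integral_rpow_mul_exp_neg_mul_Ioi hp (show 0 < z + 1 by linarith)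
    rw [integral_undef h] at h1
    have : 0 < (1 / (z + 1)) ^ p * Real.Gamma p := by positivity
    linarith
  have i2 := integrableOn_beta (a := p) (b := 1 / 2) hp (by norm_num)
  have hle : laplaceBeta p z ≤ ∫ q in Ioo (0 : ℝ) 1,
      (√2 * Real.exp 1 * (q ^ (p - 1) * Real.exp (-((z + 1) * q))) +
        Real.exp (-z / 2) * (q ^ (p - 1) * (1 - q) ^ ((1 : ℝ) / 2 - 1))) := by
    refine setIntegral_mono_on (integrableOn_laplaceBeta hp hz)
      (((i1.mono_set Ioo_subset_Ioi_self).const_mul _).add (i2.const_mul _)) measurableSet_Ioo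
      fun q hq => ?_
    have h0 := sub_pos.2 hq.2
    have h1 := hq.1
    rcases le_total q (1 / 2) with h | h
    · have e1 : (1 - q) ^ ((1 : ℝ) / 2 - 1) ≤ √2 := by
        rw [show (1 : ℝ) / 2 - 1 = -(1 / 2) by norm_num, Real.rpow_neg h0.le, ← Real.sqrt_eq_rpow,
          ← Real.sqrt_inv]
        refine Real.sqrt_le_sqrt ?_
        rw [inv_le_comm₀ h0 two_pos]
        linarith
      have e2 : Real.exp (-z * q) ≤ Real.exp 1 * Real.exp (-((z + 1) * q)) := by
        rw [← Real.exp_add]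
        exact Real.exp_le_exp.2 (by linarith [hq.2])
      have : 0 ≤ Real.exp (-z / 2) * (q ^ (p - 1) * (1 - q) ^ ((1 : ℝ) / 2 - 1)) := by positivity
      calc Real.exp (-z * q) * (q ^ (p - 1) * (1 - q) ^ ((1 : ℝ) / 2 - 1))
          ≤ (Real.exp 1 * Real.exp (-((z + 1) * q))) * (q ^ (p - 1) * √2) := by gcongr
        _ = √2 * Real.exp 1 * (q ^ (p - 1) * Real.exp (-((z + 1) * q))) := by ring
        _ ≤ _ := by linarith
    · have e2 : Real.exp (-z * q) ≤ Real.exp (-z / 2) := Real.exp_le_exp.2 (by nlinarith)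
      have : 0 ≤ √2 * Real.exp 1 * (q ^ (p - 1) * Real.exp (-((z + 1) * q))) := by positivity
      calc Real.exp (-z * q) * (q ^ (p - 1) * (1 - q) ^ ((1 : ℝ) / 2 - 1))
          ≤ Real.exp (-z / 2) * (q ^ (p - 1) * (1 - q) ^ ((1 : ℝ) / 2 - 1)) := by gcongr
        _ ≤ _ := by linarith
  rw [integral_add ((i1.mono_set Ioo_subset_Ioi_self).const_mul _) (i2.const_mul _),
    integral_const_mul, integral_const_mul, integral_beta hp (by norm_num), ← hB] at hle
  have h2 : ∫ q in Ioo (0 : ℝ) 1, q ^ (p - 1) * Real.exp (-((z + 1) * q)) ≤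
      (1 + z) ^ (-p) * Real.Gamma p := by
    rw [Real.rpow_neg (by linarith), ← Real.inv_rpow (by linarith), ← one_div, add_comm 1 z,
      ← Real.integral_rpow_mul_exp_neg_mul_Ioi hp (show 0 < z + 1 by linarith)]
    refine setIntegral_mono_set i1 (ae_restrict_of_forall_mem measurableSet_Ioi fun q hq => ?_)
      Ioo_subset_Ioi_self.eventuallyLE
    have : 0 < q := hq
    simp only [Pi.zero_apply]
    positivity
  have h3 : Real.exp (-z / 2) ≤ C₀ * (1 + z) ^ (-p) := by
    have := hC z hz
    rw [Real.rpow_neg (by linarith), ← div_eq_mul_inv, le_div_iff₀ (by positivity)]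
    calc Real.exp (-z / 2) * (1 + z) ^ p ≤ Real.exp (-z / 2) * (C₀ * Real.exp (1 / 2 * z)) := by
          gcongr
      _ = C₀ * (Real.exp (-z / 2) * Real.exp (1 / 2 * z)) := by ring
      _ = C₀ := by rw [← Real.exp_add]; ring_nf; simp
  calc laplaceBeta p z ≤ _ := hle
    _ ≤ √2 * Real.exp 1 * ((1 + z) ^ (-p) * Real.Gamma p) + C₀ * (1 + z) ^ (-p) * B := by gcongr
    _ = _ := by ring

/-- Only q < 1/(1+z) is kept: there zq ≤ 1 and (1-q)^{-1/2} ≥ 1. -/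
theorem le_laplaceBeta {p z : ℝ} (hp : 0 < p) (hz : 0 ≤ z) :
    Real.exp (-1) / p * (1 + z) ^ (-p) ≤ laplaceBeta p z := by
  have hδ : 0 < (1 + z)⁻¹ := by positivity
  have hδ1 : (1 + z)⁻¹ ≤ 1 := inv_le_one_of_one_le₀ (by linarith)
  have hi : IntegrableOn (fun q : ℝ => q ^ (p - 1)) (Ioo 0 (1 + z)⁻¹) :=
    (intervalIntegral.integrableOn_Ioo_rpow_iff hδ).2 (by linarith)
  have h1 : ∫ q in Ioo (0 : ℝ) (1 + z)⁻¹, q ^ (p - 1) = (1 + z) ^ (-p) / p := by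
    rw [← integral_Ioc_eq_integral_Ioo, ← intervalIntegral.integral_of_le hδ.le,
      integral_rpow (Or.inl (by linarith)), sub_add_cancel, Real.zero_rpow hp.ne', sub_zero,
      Real.inv_rpow (by linarith), Real.rpow_neg (by linarith)]
  have hsub : Ioo (0 : ℝ) (1 + z)⁻¹ ⊆ Ioo 0 1 := Ioo_subset_Ioo_right hδ1
  calc Real.exp (-1) / p * (1 + z) ^ (-p)
      = ∫ q in Ioo (0 : ℝ) (1 + z)⁻¹, Real.exp (-1) * q ^ (p - 1) := by
        rw [integral_const_mul, h1]; ring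
    _ ≤ ∫ q in Ioo (0 : ℝ) (1 + z)⁻¹,
          Real.exp (-z * q) * (q ^ (p - 1) * (1 - q) ^ ((1 : ℝ) / 2 - 1)) := by
        refine setIntegral_mono_on (hi.const_mul _) ((integrableOn_laplaceBeta hp hz).mono_set hsub)
          measurableSet_Ioo fun q hq => ?_
        have h0 := sub_pos.2 (hsub hq).2
        have h1 := hq.1
        have e1 : Real.exp (-1) ≤ Real.exp (-z * q) := by
          refine Real.exp_le_exp.2 ?_
          have := hq.2
          rw [lt_inv_comm₀ h1 (by linarith), ← one_div, lt_div_iff₀ h1] at this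
          linarith
        have e2 : 1 ≤ (1 - q) ^ ((1 : ℝ) / 2 - 1) :=
          Real.one_le_rpow_of_pos_of_le_one_of_nonpos h0 (by linarith) (by norm_num)
        calc Real.exp (-1) * q ^ (p - 1) ≤ Real.exp (-z * q) * (q ^ (p - 1) * 1) := by
              rw [mul_one]; gcongr
          _ ≤ _ := by gcongr
    _ ≤ laplaceBeta p z := by
        refine setIntegral_mono_set (integrableOn_laplaceBeta hp hz)
          (ae_restrict_of_forall_mem measurableSet_Ioo fun q hq => ?_) hsub.eventuallyLE
        have h0 := sub_pos.2 hq.2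
        have h1 := hq.1
        simp only [Pi.zero_apply]
        positivity

/-- These place e^{zs}, s = √(1-q), between e^z e^{-zq} and e^z e^{-zq/2}, and place 1 - s between
q/2 and q. -/
theorem sqrt_one_sub_bounds {q : ℝ} (hq : q ∈ Ioo (0 : ℝ) 1) :
    1 - q ≤ √(1 - q) ∧ √(1 - q) ≤ 1 - q / 2 := by
  have h0 := sub_pos.2 hq.2
  have h1 := hq.1
  refine ⟨Real.le_sqrt_of_sq_le (by nlinarith), ?_⟩
  rw [Real.sqrt_le_left (by linarith)]
  nlinarith [sq_nonneg q]

theorem integrableOn_poisson {α : ℝ} (hα : -1 / 2 < α) (Z : ℝ) :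
    IntegrableOn (poissonIntegrand α Z) (Ioo 0 1) := by
  refine ((integrableOn_poissonIntegrand hα Z).1.add (integrableOn_poissonIntegrand hα Z).2).congr
    (Filter.Eventually.of_forall fun q => ?_)
  simp only [poissonIntegrand, Pi.add_apply]
  ring

/-- For z ≥ 0 and s = √(1-q), cosh(zs) + s sinh(zs) lies between e^{zs}/2 and e^{zs}, so the Poisson
integral is a Laplace integral with exponent p = α + 1/2. -/
theorem dunklExp_bounds_of_nonneg {α : ℝ} (hα : -1 / 2 < α) :
    ∃ m M : ℝ, 0 < m ∧ 0 < M ∧ ∀ z : ℝ, 0 ≤ z →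
      m * (Real.exp z * (1 + z) ^ (-(α + 1 / 2))) ≤ dunklExp α z ∧
      dunklExp α z ≤ M * (Real.exp z * (1 + z) ^ (-(α + 1 / 2))) := by
  have hp : 0 < α + 1 / 2 := by linarith
  obtain ⟨C, hC, hCle⟩ := exists_laplaceBeta_le hp
  set c₀ := √Real.pi * Real.Gamma (α + 1 / 2) with hc₀
  have hc₀pos : 0 < c₀ := by
    have := Real.Gamma_pos_of_pos hp
    have := Real.pi_pos
    positivity
  refine ⟨Real.exp (-1) / (α + 1 / 2) / 2 / c₀, C * 2 ^ (α + 1 / 2) / c₀, by positivity,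
    by positivity, fun z hz => ?_⟩
  have hD := integral_poissonIntegrand hα z
  rw [← hc₀] at hD
  have hlow : Real.exp z / 2 * laplaceBeta (α + 1 / 2) z ≤ c₀ * dunklExp α z := by
    rw [← hD, laplaceBeta, ← integral_const_mul]
    refine setIntegral_mono_on ((integrableOn_laplaceBeta hp hz).const_mul _)
      (integrableOn_poisson hα z) measurableSet_Ioo fun q hq => ?_
    have h0 := sub_pos.2 hq.2
    have h1 := hq.1
    have hs := sqrt_one_sub_bounds hq
    rw [poissonIntegrand, ← mul_assoc]
    gcongr
    have e1 : Real.exp z * Real.exp (-z * q) ≤ Real.exp (z * √(1 - q)) := by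
      rw [← Real.exp_add]
      exact Real.exp_le_exp.2 (by nlinarith)
    have e2 : 0 ≤ √(1 - q) * Real.sinh (z * √(1 - q)) :=
      mul_nonneg (Real.sqrt_nonneg _) (Real.sinh_nonneg_iff.2 (by positivity))
    rw [Real.cosh_eq]
    linarith [Real.exp_pos (-(z * √(1 - q)))]
  have hupp : c₀ * dunklExp α z ≤ Real.exp z * laplaceBeta (α + 1 / 2) (z / 2) := by
    rw [← hD, laplaceBeta, ← integral_const_mul]
    refine setIntegral_mono_on (integrableOn_poisson hα z)
      ((integrableOn_laplaceBeta hp (by positivity)).const_mul _) measurableSet_Ioo fun q hq => ?_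
    have h0 := sub_pos.2 hq.2
    have h1 := hq.1
    have hs := sqrt_one_sub_bounds hq
    rw [poissonIntegrand, ← mul_assoc (Real.exp z)]
    refine mul_le_mul_of_nonneg_right ?_ (by positivity)
    have e1 : Real.exp (z * √(1 - q)) ≤ Real.exp z * Real.exp (-(z / 2) * q) := by
      rw [← Real.exp_add]
      exact Real.exp_le_exp.2 (by nlinarith)
    have e2 : √(1 - q) * Real.sinh (z * √(1 - q)) ≤ 1 * Real.sinh (z * √(1 - q)) := by
      have : 0 ≤ Real.sinh (z * √(1 - q)) := Real.sinh_nonneg_iff.2 (by positivity)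
      gcongr
      linarith
    linarith [Real.cosh_add_sinh (z * √(1 - q))]
  constructor
  · have h1 := le_laplaceBeta hp hz
    have h2 : Real.exp z / 2 * (Real.exp (-1) / (α + 1 / 2) * (1 + z) ^ (-(α + 1 / 2))) ≤
        c₀ * dunklExp α z := le_trans (by gcongr) hlow
    rw [← mul_le_mul_iff_right₀ hc₀pos]
    refine le_trans (le_of_eq ?_) h2
    field_simp
  · have h1 := hCle (z / 2) (by positivity)
    have h2 : (1 + z / 2) ^ (-(α + 1 / 2)) ≤ 2 ^ (α + 1 / 2) * (1 + z) ^ (-(α + 1 / 2)) := by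
      rw [← neg_neg (α + 1 / 2), neg_neg (-(α + 1 / 2)), Real.rpow_neg two_pos.le (-(α + 1 / 2)),
        ← Real.inv_rpow two_pos.le, ← Real.mul_rpow (by positivity) (by positivity)]
      exact Real.rpow_le_rpow_of_nonpos (by positivity) (by linarith) (by linarith)
    rw [← mul_le_mul_iff_right₀ hc₀pos]
    calc c₀ * dunklExp α z ≤ Real.exp z * laplaceBeta (α + 1 / 2) (z / 2) := hupp
      _ ≤ Real.exp z * (C * (2 ^ (α + 1 / 2) * (1 + z) ^ (-(α + 1 / 2)))) := by
        have h3 := mul_le_mul_of_nonneg_left h2 hC.le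
        exact mul_le_mul_of_nonneg_left (h1.trans h3) (Real.exp_nonneg _)
      _ = _ := by field_simp

/-- Now cosh(zs) - s sinh(zs) = ((1-s)e^{zs} + (1+s)e^{-zs})/2. The factor 1 - s is comparable to q,
which raises the Laplace exponent to p = α + 3/2. -/
theorem dunklExp_bounds_neg {α : ℝ} (hα : -1 / 2 < α) :
    ∃ m M : ℝ, 0 < m ∧ 0 < M ∧ ∀ z : ℝ, 0 ≤ z →
      m * (Real.exp z * (1 + z) ^ (-(α + 3 / 2))) ≤ dunklExp α (-z) ∧
      dunklExp α (-z) ≤ M * (Real.exp z * (1 + z) ^ (-(α + 3 / 2))) := by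
  have hp : 0 < α + 1 / 2 := by linarith
  have hp' : 0 < α + 3 / 2 := by linarith
  obtain ⟨C, hC, hCle⟩ := exists_laplaceBeta_le hp'
  obtain ⟨C₁, hC₁, hC₁le⟩ := exists_one_add_rpow_le_exp (α + 3 / 2) one_pos
  set B := Real.Gamma (α + 1 / 2) * Real.Gamma (1 / 2) / Real.Gamma (α + 1 / 2 + 1 / 2) with hB
  have hBpos : 0 < B := ProbabilityTheory.beta_pos hp (by norm_num)
  set c₀ := √Real.pi * Real.Gamma (α + 1 / 2) with hc₀
  have hc₀pos : 0 < c₀ := by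
    have := Real.Gamma_pos_of_pos hp
    have := Real.pi_pos
    positivity
  refine ⟨Real.exp (-1) / (α + 3 / 2) / 4 / c₀, (C * 2 ^ (α + 3 / 2) + C₁ * B) / c₀,
    by positivity, by positivity, fun z hz => ?_⟩
  have hD := integral_poissonIntegrand hα (-z)
  rw [← hc₀] at hD
  have hpow : ∀ q : ℝ, 0 < q → q ^ (α + 3 / 2 - 1) = q * q ^ (α + 1 / 2 - 1) := fun q hq => by
    rw [← Real.rpow_one_add' hq.le (by linarith)]; congr 1; ring
  have hsplit : ∀ s : ℝ, Real.cosh (-z * s) + s * Real.sinh (-z * s) =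
      (1 - s) * Real.exp (z * s) / 2 + (1 + s) * Real.exp (-(z * s)) / 2 := fun s => by
    rw [neg_mul, Real.cosh_neg, Real.sinh_neg, Real.cosh_eq, Real.sinh_eq]; ring
  have hlow : Real.exp z / 4 * laplaceBeta (α + 3 / 2) z ≤ c₀ * dunklExp α (-z) := by
    rw [← hD, laplaceBeta, ← integral_const_mul]
    refine setIntegral_mono_on ((integrableOn_laplaceBeta hp' hz).const_mul _)
      (integrableOn_poisson hα _) measurableSet_Ioo fun q hq => ?_
    have h0 := sub_pos.2 hq.2
    have h1 := hq.1
    have hs := sqrt_one_sub_bounds hq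
    rw [poissonIntegrand, hsplit, hpow q h1]
    have e1 : Real.exp z * Real.exp (-z * q) ≤ Real.exp (z * √(1 - q)) := by
      rw [← Real.exp_add]
      exact Real.exp_le_exp.2 (by nlinarith)
    have e2 : q / 2 * (Real.exp z * Real.exp (-z * q)) ≤
        (1 - √(1 - q)) * Real.exp (z * √(1 - q)) := by gcongr <;> linarith
    have e3 : 0 ≤ (1 + √(1 - q)) * Real.exp (-(z * √(1 - q))) := by positivity
    calc Real.exp z / 4 * (Real.exp (-z * q) *
          (q * q ^ (α + 1 / 2 - 1) * (1 - q) ^ ((1 : ℝ) / 2 - 1)))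
        = (q / 2 * (Real.exp z * Real.exp (-z * q)) / 2) *
          (q ^ (α + 1 / 2 - 1) * (1 - q) ^ ((1 : ℝ) / 2 - 1)) := by ring
      _ ≤ _ := by
        gcongr
        linarith
  have hupp : c₀ * dunklExp α (-z) ≤ Real.exp z * laplaceBeta (α + 3 / 2) (z / 2) + B := by
    rw [← hD, laplaceBeta, ← integral_const_mul, hB, ← integral_beta hp (by norm_num),
      ← integral_add ((integrableOn_laplaceBeta hp' (by positivity)).const_mul _)
        (integrableOn_beta hp (by norm_num))]
    refine setIntegral_mono_on (integrableOn_poisson hα _)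
      (((integrableOn_laplaceBeta hp' (by positivity)).const_mul _).add
        (integrableOn_beta hp (by norm_num))) measurableSet_Ioo fun q hq => ?_
    have h0 := sub_pos.2 hq.2
    have h1 := hq.1
    have hs := sqrt_one_sub_bounds hq
    rw [poissonIntegrand, hsplit, hpow q h1]
    have e1 : Real.exp (z * √(1 - q)) ≤ Real.exp z * Real.exp (-(z / 2) * q) := by
      rw [← Real.exp_add]
      exact Real.exp_le_exp.2 (by nlinarith)
    have e2 : (1 - √(1 - q)) * Real.exp (z * √(1 - q)) ≤
        q * (Real.exp z * Real.exp (-(z / 2) * q)) := by gcongr ; linarith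
    have e4 : Real.exp (-(z * √(1 - q))) ≤ 1 :=
      Real.exp_le_one_iff.2 (neg_nonpos.2 (by positivity))
    have e3 : (1 + √(1 - q)) * Real.exp (-(z * √(1 - q))) ≤ 2 * 1 := by gcongr ; linarith
    have e5 : 0 ≤ q * (Real.exp z * Real.exp (-(z / 2) * q)) := by positivity
    calc _ ≤ (q * (Real.exp z * Real.exp (-(z / 2) * q)) + 1) *
          (q ^ (α + 1 / 2 - 1) * (1 - q) ^ ((1 : ℝ) / 2 - 1)) := by
          refine mul_le_mul_of_nonneg_right ?_ (by positivity)
          linarith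
      _ = _ := by ring
  constructor
  · have h1 := le_laplaceBeta hp' hz
    have h2 : Real.exp z / 4 * (Real.exp (-1) / (α + 3 / 2) * (1 + z) ^ (-(α + 3 / 2))) ≤
        c₀ * dunklExp α (-z) := le_trans (by gcongr) hlow
    rw [← mul_le_mul_iff_right₀ hc₀pos]
    refine le_trans (le_of_eq ?_) h2
    field_simp
  · have h1 := hCle (z / 2) (by positivity)
    have h2 : (1 + z / 2) ^ (-(α + 3 / 2)) ≤ 2 ^ (α + 3 / 2) * (1 + z) ^ (-(α + 3 / 2)) := by
      rw [← neg_neg (α + 3 / 2), neg_neg (-(α + 3 / 2)), Real.rpow_neg two_pos.le (-(α + 3 / 2)),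
        ← Real.inv_rpow two_pos.le, ← Real.mul_rpow (by positivity) (by positivity)]
      exact Real.rpow_le_rpow_of_nonpos (by positivity) (by linarith) (by linarith)
    -- The bounded remainder B from the e^{-zs} term is absorbed, because e^z (1+z)^{-α-3/2} is
    -- bounded below.
    have h3 : 1 ≤ C₁ * (Real.exp z * (1 + z) ^ (-(α + 3 / 2))) := by
      have := hC₁le z hz
      rw [one_mul] at this
      rw [Real.rpow_neg (by positivity), ← mul_assoc, ← div_eq_mul_inv, le_div_iff₀ (by positivity),
        one_mul]
      exact this
    rw [← mul_le_mul_iff_right₀ hc₀pos]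
    calc c₀ * dunklExp α (-z) ≤ Real.exp z * laplaceBeta (α + 3 / 2) (z / 2) + B := hupp
      _ ≤ Real.exp z * (C * (2 ^ (α + 3 / 2) * (1 + z) ^ (-(α + 3 / 2)))) +
          C₁ * (Real.exp z * (1 + z) ^ (-(α + 3 / 2))) * B := by
        have h4 := mul_le_mul_of_nonneg_left h2 hC.le
        exact add_le_add (mul_le_mul_of_nonneg_left (h1.trans h4) (Real.exp_nonneg _))
          (le_mul_of_one_le_left hBpos.le h3)
      _ = _ := by field_simp

/-! ### Gaussian bounds and reduction to the model integral. -/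

/-- The model integrand to which the Bessel potential kernel is compared. -/
noncomputable def profile (α σ c a b t : ℝ) : ℝ :=
  Real.exp (-t - c * a ^ 2 / t) * t ^ (σ - 3 / 2) * (t + b ^ 2) ^ (-(α + 1 / 2))

theorem profile_nonneg {α σ c a b t : ℝ} (ht : 0 < t) : 0 ≤ profile α σ c a b t := by
  rw [profile]; positivity

theorem profile_eq {α σ c a b t : ℝ} (ht : 0 < t) :
    profile α σ c a b t = Real.exp (-t) * (t ^ (σ - α - 2) * Real.exp (-(c * a ^ 2 / t)) *
      (1 + b ^ 2 / t) ^ (-(α + 1 / 2))) := by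
  have e : 1 + b ^ 2 / t = (t + b ^ 2) / t := by field_simp
  rw [profile, e, Real.div_rpow (by positivity) ht.le, sub_eq_add_neg (-t), Real.exp_add,
    show σ - 3 / 2 = (σ - α - 2) - (-(α + 1 / 2)) by ring, Real.rpow_sub ht]
  ring

/-- Replacing `1 + z`, `z = (b² - a²)/(8t)`, by `1 + b²/t`, at the cost of a fraction of the
Gaussian factor. -/
theorem exists_gaussian_rpow_le {β : ℝ} (hβ : 0 < β) :
    ∃ C : ℝ, 0 < C ∧ ∀ a b t z : ℝ, 0 < t → 0 ≤ z → 8 * z * t = b ^ 2 - a ^ 2 →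
      Real.exp (-(1 / 4 * a ^ 2 / t)) * (1 + b ^ 2 / t) ^ (-β) ≤
        Real.exp (-(1 / 4 * a ^ 2 / t)) * (1 + z) ^ (-β) ∧
      Real.exp (-(1 / 4 * a ^ 2 / t)) * (1 + z) ^ (-β) ≤
        C * (Real.exp (-(1 / 8 * a ^ 2 / t)) * (1 + b ^ 2 / t) ^ (-β)) := by
  obtain ⟨C, hC, hCle⟩ := exists_one_add_rpow_le_exp β (ε := 1 / 8) (by norm_num)
  refine ⟨8 ^ β * C, by positivity, fun a b t z ht hz h => ?_⟩
  have hb : b ^ 2 / t = a ^ 2 / t + 8 * z := by field_simp; linarith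
  have ha : 0 ≤ a ^ 2 / t := by positivity
  constructor
  · gcongr ?_ * ?_
    exact Real.rpow_le_rpow_of_nonpos (by positivity) (by linarith) (by linarith)
  -- From b²/t = a²/t + 8z, the quotient of the two weights is at most a multiple of (1+a²/t)^β,
  -- which the drop from 1/4 to 1/8 in the Gaussian pays for.
  · have h1 : 1 + b ^ 2 / t ≤ 8 * (1 + z) * (1 + a ^ 2 / t) := by rw [hb]; nlinarith
    have h2 : (1 + b ^ 2 / t) ^ β ≤ 8 ^ β * (1 + z) ^ β * (C * Real.exp (1 / 8 * (a ^ 2 / t))) := by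
      calc (1 + b ^ 2 / t) ^ β ≤ (8 * (1 + z) * (1 + a ^ 2 / t)) ^ β := by gcongr
        _ = 8 ^ β * (1 + z) ^ β * (1 + a ^ 2 / t) ^ β := by
          rw [Real.mul_rpow (by positivity) (by positivity),
            Real.mul_rpow (by positivity) (by positivity)]
        _ ≤ _ := mul_le_mul_of_nonneg_left (hCle _ ha) (by positivity)
    rw [Real.rpow_neg (by positivity), Real.rpow_neg (by positivity), ← div_eq_mul_inv,
      ← div_eq_mul_inv, ← mul_div_assoc, div_le_div_iff₀ (by positivity) (by positivity)]
    have e : Real.exp (-(1 / 8 * a ^ 2 / t)) =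
        Real.exp (-(1 / 4 * a ^ 2 / t)) * Real.exp (1 / 8 * (a ^ 2 / t)) := by
      rw [← Real.exp_add]; congr 1; ring
    rw [e]
    calc Real.exp (-(1 / 4 * a ^ 2 / t)) * (1 + b ^ 2 / t) ^ β ≤ Real.exp (-(1 / 4 * a ^ 2 / t)) *
          (8 ^ β * (1 + z) ^ β * (C * Real.exp (1 / 8 * (a ^ 2 / t)))) := by gcongr
      _ = _ := by ring

/-- Here ε = ±1 is a sign making εxy ≥ 0, so εxy = |xy|. With z = |xy|/(2t), a = |x-εy| and b =
|x|+|y|, completing the square gives e^{-(x²+y²)/(4t)} e^z = e^{-a²/(4t)} and 8zt = b² - a². -/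
theorem heatKernel_sandwich {α : ℝ} (hα : -1 / 2 < α) {β : ℝ} (hβ : 0 < β) (ε : ℝ)
    (hD : ∃ m M : ℝ, 0 < m ∧ 0 < M ∧ ∀ z : ℝ, 0 ≤ z →
      m * (Real.exp z * (1 + z) ^ (-β)) ≤ dunklExp α (ε * z) ∧
      dunklExp α (ε * z) ≤ M * (Real.exp z * (1 + z) ^ (-β))) (hε : ε ^ 2 = 1) :
    ∃ m M : ℝ, 0 < m ∧ 0 < M ∧ ∀ x y t : ℝ, 0 < t → 0 ≤ ε * (x * y) →
      m * (t ^ (-(α + 1)) * Real.exp (-(1 / 4 * |x - ε * y| ^ 2 / t)) *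
        (1 + (|x| + |y|) ^ 2 / t) ^ (-β)) ≤ (heatKernel α t x y).re ∧
      (heatKernel α t x y).re ≤ M * (t ^ (-(α + 1)) * Real.exp (-(1 / 8 * |x - ε * y| ^ 2 / t)) *
        (1 + (|x| + |y|) ^ 2 / t) ^ (-β)) := by
  obtain ⟨m, M, hm, hM, hD⟩ := hD
  obtain ⟨C, hC, hG⟩ := exists_gaussian_rpow_le hβ
  refine ⟨4 ^ (-(α + 1)) * m, 4 ^ (-(α + 1)) * (M * C), by positivity, by positivity,
    fun x y t ht hxy => ?_⟩
  set z := ε * (x * y) / (2 * t) with hz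
  have hz0 : 0 ≤ z := by positivity
  have hzxy : ε * z = x * y / (2 * t) := by
    rw [hz]; linear_combination (x * y / (2 * t)) * hε
  have habs : ε * (x * y) = |x| * |y| := by
    have h1 : |ε| = 1 := by
      rwa [← sq_abs, pow_eq_one_iff_of_nonneg (abs_nonneg _) two_ne_zero] at hε
    rw [← abs_of_nonneg hxy, abs_mul, abs_mul, h1, one_mul]
  have ha : |x - ε * y| ^ 2 = x ^ 2 + y ^ 2 - 2 * (ε * (x * y)) := by
    rw [sq_abs]; linear_combination y ^ 2 * hε
  have hb : (|x| + |y|) ^ 2 = x ^ 2 + y ^ 2 + 2 * (ε * (x * y)) := by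
    rw [habs, ← sq_abs x, ← sq_abs y]; ring
  have h8 : 8 * z * t = (|x| + |y|) ^ 2 - |x - ε * y| ^ 2 := by
    rw [ha, hb, hz]; field_simp; ring
  obtain ⟨g1, g2⟩ := hG _ _ t z ht hz0 h8
  obtain ⟨d1, d2⟩ := hD z hz0
  have hexp : Real.exp (-(x ^ 2 + y ^ 2) / (4 * t)) * Real.exp z =
      Real.exp (-(1 / 4 * |x - ε * y| ^ 2 / t)) := by
    rw [← Real.exp_add, ha, hz]; congr 1; field_simp; ring
  rw [heatKernel_re hα ht, ← hzxy]
  constructor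
  · calc _ = 4 ^ (-(α + 1)) * t ^ (-(α + 1)) * (m * (Real.exp (-(1 / 4 * |x - ε * y| ^ 2 / t)) *
          (1 + (|x| + |y|) ^ 2 / t) ^ (-β))) := by ring
      _ ≤ 4 ^ (-(α + 1)) * t ^ (-(α + 1)) * (m * (Real.exp (-(1 / 4 * |x - ε * y| ^ 2 / t)) *
          (1 + z) ^ (-β))) := by
        refine mul_le_mul_of_nonneg_left (mul_le_mul_of_nonneg_left g1 hm.le) (by positivity)
      _ = 4 ^ (-(α + 1)) * t ^ (-(α + 1)) * Real.exp (-(x ^ 2 + y ^ 2) / (4 * t)) *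
          (m * (Real.exp z * (1 + z) ^ (-β))) := by rw [← hexp]; ring
      _ ≤ _ := mul_le_mul_of_nonneg_left d1 (by positivity)
  · calc _ ≤ 4 ^ (-(α + 1)) * t ^ (-(α + 1)) * Real.exp (-(x ^ 2 + y ^ 2) / (4 * t)) *
          (M * (Real.exp z * (1 + z) ^ (-β))) := mul_le_mul_of_nonneg_left d2 (by positivity)
      _ = 4 ^ (-(α + 1)) * t ^ (-(α + 1)) * (M * (Real.exp (-(1 / 4 * |x - ε * y| ^ 2 / t)) *
          (1 + z) ^ (-β))) := by rw [← hexp]; ring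
      _ ≤ 4 ^ (-(α + 1)) * t ^ (-(α + 1)) * (M * (C * (Real.exp (-(1 / 8 * |x - ε * y| ^ 2 / t)) *
          (1 + (|x| + |y|) ^ 2 / t) ^ (-β)))) := by
        refine mul_le_mul_of_nonneg_left (mul_le_mul_of_nonneg_left g2 hM.le) (by positivity)
      _ = _ := by ring

/-- The integral of the model integrand, an element of `[0, ∞]`. -/
noncomputable def profileIntegral (α σ c a b : ℝ) : ℝ≥0∞ :=
  ∫⁻ t in Ioi (0 : ℝ), ENNReal.ofReal (profile α σ c a b t)

/-- The power t^{σ-α-2} in `profile_eq` depends only on σ - α. Extra decay κ in the weight is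
therefore accounted for by moving both parameters by κ. -/
theorem besselKernel_sandwich {α σ : ℝ} (hσ : 0 < σ) (κ ε : ℝ) (S : ℝ → ℝ → Prop)
    (h : ∃ m M : ℝ, 0 < m ∧ 0 < M ∧ ∀ x y t : ℝ, 0 < t → S x y →
      m * (t ^ (-(α + 1)) * Real.exp (-(1 / 4 * |x - ε * y| ^ 2 / t)) *
        (1 + (|x| + |y|) ^ 2 / t) ^ (-(α + κ + 1 / 2))) ≤ (heatKernel α t x y).re ∧
      (heatKernel α t x y).re ≤ M * (t ^ (-(α + 1)) * Real.exp (-(1 / 8 * |x - ε * y| ^ 2 / t)) *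
        (1 + (|x| + |y|) ^ 2 / t) ^ (-(α + κ + 1 / 2)))) :
    ∃ m M : ℝ, 0 < m ∧ 0 < M ∧ ∀ x y : ℝ, S x y →
      ((ENNReal.ofReal m * profileIntegral (α + κ) (σ + κ) (1 / 4) |x - ε * y| (|x| + |y|) :
        ℝ≥0∞) : EReal) ≤ besselKernel α σ x y ∧
      besselKernel α σ x y ≤
        ((ENNReal.ofReal M * profileIntegral (α + κ) (σ + κ) (1 / 8) |x - ε * y| (|x| + |y|) :
          ℝ≥0∞) : EReal) := by
  obtain ⟨m, M, hm, hM, h⟩ := h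
  have hΓ := Real.Gamma_pos_of_pos hσ
  refine ⟨(Real.Gamma σ)⁻¹ * m, (Real.Gamma σ)⁻¹ * M, by positivity, by positivity,
    fun x y hS => ?_⟩
  have hprof : ∀ c t : ℝ, 0 < t → profile (α + κ) (σ + κ) c |x - ε * y| (|x| + |y|) t =
      Real.exp (-t) * (t ^ (-(α + 1)) * Real.exp (-(c * |x - ε * y| ^ 2 / t)) *
        (1 + (|x| + |y|) ^ 2 / t) ^ (-(α + κ + 1 / 2))) * t ^ (σ - 1) := fun c t ht => by
    rw [profile_eq ht, show σ + κ - (α + κ) - 2 = -(α + 1) + (σ - 1) by ring, Real.rpow_add ht]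
    ring
  have hlow : ∀ t ∈ Ioi (0 : ℝ), (Real.Gamma σ)⁻¹ * m *
      profile (α + κ) (σ + κ) (1 / 4) |x - ε * y| (|x| + |y|) t ≤
        (Real.Gamma σ)⁻¹ * (Real.exp (-t) * (heatKernel α t x y).re * t ^ (σ - 1)) := by
    intro t ht
    have ht : 0 < t := ht
    rw [hprof _ t ht, mul_assoc]
    refine mul_le_mul_of_nonneg_left ?_ (by positivity)
    calc _ = Real.exp (-t) * (m * (t ^ (-(α + 1)) * Real.exp (-(1 / 4 * |x - ε * y| ^ 2 / t)) *
        (1 + (|x| + |y|) ^ 2 / t) ^ (-(α + κ + 1 / 2)))) * t ^ (σ - 1) := by ring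
      _ ≤ _ := mul_le_mul_of_nonneg_right
        (mul_le_mul_of_nonneg_left (h x y t ht hS).1 (by positivity)) (by positivity)
  have hupp : ∀ t ∈ Ioi (0 : ℝ),
        (Real.Gamma σ)⁻¹ * (Real.exp (-t) * (heatKernel α t x y).re * t ^ (σ - 1)) ≤
      (Real.Gamma σ)⁻¹ * M *
      profile (α + κ) (σ + κ) (1 / 8) |x - ε * y| (|x| + |y|) t := by
    intro t ht
    have ht : 0 < t := ht
    rw [hprof _ t ht, mul_assoc (Real.Gamma σ)⁻¹ M]
    refine mul_le_mul_of_nonneg_left ?_ (by positivity)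
    calc _ ≤ Real.exp (-t) * (M * (t ^ (-(α + 1)) * Real.exp (-(1 / 8 * |x - ε * y| ^ 2 / t)) *
        (1 + (|x| + |y|) ^ 2 / t) ^ (-(α + κ + 1 / 2)))) * t ^ (σ - 1) :=
          mul_le_mul_of_nonneg_right
            (mul_le_mul_of_nonneg_left (h x y t ht hS).2 (by positivity)) (by positivity)
      _ = _ := by ring
  -- The lower bound makes the integrand nonnegative, so the negative part in the extended-real
  -- definition vanishes.
  have hneg : ∫⁻ t in Ioi (0 : ℝ), ENNReal.ofReal (-((Real.Gamma σ)⁻¹ *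
      (Real.exp (-t) * (heatKernel α t x y).re * t ^ (σ - 1)))) = 0 := by
    refine (setLIntegral_congr_fun (g := fun _ => (0 : ℝ≥0∞)) measurableSet_Ioi
      fun t ht => ?_).trans lintegral_zero
    refine ENNReal.ofReal_eq_zero.2 (neg_nonpos.2 (le_trans ?_ (hlow t ht)))
    have := profile_nonneg (α := α + κ) (σ := σ + κ) (c := 1 / 4) (a := |x - ε * y|)
      (b := |x| + |y|) ht
    positivity
  rw [besselKernel, hneg, EReal.coe_ennreal_zero, sub_zero]
  constructor
  · rw [EReal.coe_ennreal_le_coe_ennreal_iff, profileIntegral,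
      ← lintegral_const_mul' _ _ ENNReal.ofReal_ne_top]
    refine setLIntegral_mono' measurableSet_Ioi fun t ht => ?_
    rw [← ENNReal.ofReal_mul (by positivity)]
    exact ENNReal.ofReal_le_ofReal (hlow t ht)
  · rw [EReal.coe_ennreal_le_coe_ennreal_iff, profileIntegral,
      ← lintegral_const_mul' _ _ ENNReal.ofReal_ne_top]
    refine setLIntegral_mono' measurableSet_Ioi fun t ht => ?_
    rw [← ENNReal.ofReal_mul (by positivity)]
    exact ENNReal.ofReal_le_ofReal (hupp t ht)

theorem besselKernel_same_sign {α σ : ℝ} (hα : -1 / 2 < α) (hσ : 0 < σ) :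
    ∃ m M : ℝ, 0 < m ∧ 0 < M ∧ ∀ x y : ℝ, 0 ≤ x * y →
      ((ENNReal.ofReal m * profileIntegral α σ (1 / 4) |x - y| (|x| + |y|) :
        ℝ≥0∞) : EReal) ≤ besselKernel α σ x y ∧
      besselKernel α σ x y ≤
        ((ENNReal.ofReal M * profileIntegral α σ (1 / 8) |x - y| (|x| + |y|) :
          ℝ≥0∞) : EReal) := by
  have h := besselKernel_sandwich hσ 0 1 (fun x y => 0 ≤ 1 * (x * y))
    (heatKernel_sandwich hα (β := α + 0 + 1 / 2) (by linarith) 1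
      (by simpa using dunklExp_bounds_of_nonneg hα) (by norm_num))
  simpa using h

theorem besselKernel_opposite_sign {α σ : ℝ} (hα : -1 / 2 < α) (hσ : 0 < σ) :
    ∃ m M : ℝ, 0 < m ∧ 0 < M ∧ ∀ x y : ℝ, x * y < 0 →
      ((ENNReal.ofReal m * profileIntegral (α + 1) (σ + 1) (1 / 4) |x + y| (|x| + |y|) :
        ℝ≥0∞) : EReal) ≤ besselKernel α σ x y ∧
      besselKernel α σ x y ≤
        ((ENNReal.ofReal M * profileIntegral (α + 1) (σ + 1) (1 / 8) |x + y| (|x| + |y|) :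
          ℝ≥0∞) : EReal) := by
  have hD := dunklExp_bounds_neg hα
  rw [show α + 3 / 2 = α + 1 + 1 / 2 by ring] at hD
  obtain ⟨m, M, hm, hM, h⟩ := besselKernel_sandwich hσ 1 (-1) (fun x y => 0 ≤ (-1) * (x * y))
    (heatKernel_sandwich hα (β := α + 1 + 1 / 2) (by linarith) (-1)
      (by simpa only [neg_one_mul] using hD) (by norm_num))
  refine ⟨m, M, hm, hM, fun x y hxy => ?_⟩
  have := h x y (by linarith)
  rwa [neg_one_mul, sub_neg_eq_add] at this

/-! ### Elementary integrals, and pieces bounding the model integral from below. -/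

theorem sq_rpow {b : ℝ} (hb : 0 ≤ b) (s : ℝ) : (b ^ 2) ^ s = b ^ (2 * s) := by
  rw [← Real.rpow_two, ← Real.rpow_mul hb]

theorem lintegral_rpow_eq_top {s A : ℝ} (hs : s ≤ -1) (hA : 0 < A) :
    ∫⁻ t in Ioc (0 : ℝ) A, ENNReal.ofReal (t ^ s) = ⊤ := by
  by_contra h
  have h1 : IntegrableOn (fun t : ℝ => t ^ s) (Ioo 0 A) := by
    rw [← integrableOn_Ioc_iff_integrableOn_Ioo, IntegrableOn, ← lintegral_ofReal_ne_top_iff_integrable]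
    · exact h
    · fun_prop
    · refine ae_restrict_of_forall_mem measurableSet_Ioc fun t ht => ?_
      have := ht.1
      simp only [Pi.zero_apply]
      positivity
  have := (intervalIntegral.integrableOn_Ioo_rpow_iff hA).1 h1
  linarith

theorem lintegral_Ioc_inv {l u : ℝ} (hl : 0 < l) (hlu : l ≤ u) :
    ∫⁻ t in Ioc l u, ENNReal.ofReal (t⁻¹) = ENNReal.ofReal (Real.log (u / l)) := by
  have h0 : (0 : ℝ) ∉ uIcc l u := by
    rw [uIcc_of_le hlu]; exact fun h => by linarith [h.1]
  rw [← integral_inv h0, intervalIntegral.integral_of_le hlu, ofReal_integral_eq_lintegral_ofReal]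
  · exact (intervalIntegral.intervalIntegrable_inv (fun x hx h => h0 (h ▸ hx))
      continuousOn_id).1
  · refine ae_restrict_of_forall_mem measurableSet_Ioc fun t ht => ?_
    have := hl.trans ht.1
    simp only [Pi.zero_apply]
    positivity

theorem lintegral_Ioc_rpow {s A : ℝ} (hs : -1 < s) (hA : 0 ≤ A) :
    ∫⁻ t in Ioc (0 : ℝ) A, ENNReal.ofReal (t ^ s) = ENNReal.ofReal (A ^ (s + 1) / (s + 1)) := by
  have h1 : ∫ t in (0 : ℝ)..A, t ^ s = A ^ (s + 1) / (s + 1) := by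
    rw [integral_rpow (Or.inl hs), Real.zero_rpow (by linarith), sub_zero]
  rw [← h1, intervalIntegral.integral_of_le hA, ofReal_integral_eq_lintegral_ofReal]
  · exact (intervalIntegral.intervalIntegrable_rpow' hs).1
  · refine ae_restrict_of_forall_mem measurableSet_Ioc fun t ht => ?_
    have := ht.1
    simp only [Pi.zero_apply]
    positivity

theorem lintegral_Ioi_rpow {s A : ℝ} (hs : s < -1) (hA : 0 < A) :
    ∫⁻ t in Ioi A, ENNReal.ofReal (t ^ s) = ENNReal.ofReal (A ^ (s + 1) / -(s + 1)) := by
  rw [div_neg, ← neg_div, ← integral_Ioi_rpow_of_lt hs hA, ofReal_integral_eq_lintegral_ofReal]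
  · exact integrableOn_Ioi_rpow_of_lt hs hA
  · refine ae_restrict_of_forall_mem measurableSet_Ioi fun t ht => ?_
    have : 0 < t := hA.trans ht
    simp only [Pi.zero_apply]
    positivity

theorem lintegral_Ioi_exp_rpow {s r : ℝ} (hs : 0 < s) (hr : 0 < r) :
    ∫⁻ t in Ioi (0 : ℝ), ENNReal.ofReal (t ^ (s - 1) * Real.exp (-(r * t))) =
      ENNReal.ofReal ((1 / r) ^ s * Real.Gamma s) := by
  have h1 := Real.integral_rpow_mul_exp_neg_mul_Ioi hs hr
  rw [← h1, ofReal_integral_eq_lintegral_ofReal]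
  · by_contra h
    rw [integral_undef h] at h1
    have := Real.Gamma_pos_of_pos hs
    have : 0 < (1 / r) ^ s * Real.Gamma s := by positivity
    linarith
  · refine ae_restrict_of_forall_mem measurableSet_Ioi fun t ht => ?_
    have : 0 < t := ht
    simp only [Pi.zero_apply]
    positivity

theorem le_profileIntegral {α σ c a b l u K : ℝ} (hl : 0 ≤ l) (hK : 0 ≤ K) {g : ℝ → ℝ}
    (h : ∀ t ∈ Ioc l u, K * g t ≤ profile α σ c a b t) :
    ENNReal.ofReal K * ∫⁻ t in Ioc l u, ENNReal.ofReal (g t) ≤ profileIntegral α σ c a b := by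
  rw [← lintegral_const_mul' _ _ ENNReal.ofReal_ne_top]
  calc _ ≤ ∫⁻ t in Ioc l u, ENNReal.ofReal (profile α σ c a b t) := by
        refine setLIntegral_mono' measurableSet_Ioc fun t ht => ?_
        rw [← ENNReal.ofReal_mul hK]
        exact ENNReal.ofReal_le_ofReal (h t ht)
    _ ≤ _ := lintegral_mono_set fun t ht => lt_of_le_of_lt hl ht.1

/-- The exponent -|s| covers increasing and decreasing powers at once. -/
theorem rpow_block_le {s r t : ℝ} (hr : 0 < r) (h1 : r ≤ t) (h2 : t ≤ 2 * r) :
    2 ^ (-|s|) * r ^ s ≤ t ^ s := by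
  have ht : t = (t / r) * r := by field_simp
  have h3 : 1 ≤ t / r := (one_le_div hr).2 h1
  have h4 : t / r ≤ 2 := (div_le_iff₀ hr).2 h2
  rw [ht, Real.mul_rpow (by positivity) hr.le]
  gcongr
  calc (2 : ℝ) ^ (-|s|) ≤ (t / r) ^ (-|s|) :=
        Real.rpow_le_rpow_of_nonpos (by positivity) h4 (neg_nonpos.2 (abs_nonneg s))
    _ ≤ (t / r) ^ s := Real.rpow_le_rpow_of_exponent_le h3 (neg_abs_le s)

/-- The contribution of `[r, 2r]` to the model integral. -/
theorem block_le_profileIntegral {α σ c a b r : ℝ} (hα : -1 / 2 < α) (hc : 0 < c) (hr : 0 < r) :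
    ENNReal.ofReal (Real.exp (-(2 * r) - c * a ^ 2 / r) * (2 ^ (-|σ - 3 / 2|) *
      (r ^ (σ - 1 / 2) * (2 * r + b ^ 2) ^ (-(α + 1 / 2))))) ≤ profileIntegral α σ c a b := by
  have hp : 0 < α + 1 / 2 := by linarith
  have h := le_profileIntegral (α := α) (σ := σ) (c := c) (a := a) (b := b) (l := r) (u := 2 * r)
    (K := Real.exp (-(2 * r) - c * a ^ 2 / r) * (2 ^ (-|σ - 3 / 2|) *
      (r ^ (σ - 3 / 2) * (2 * r + b ^ 2) ^ (-(α + 1 / 2))))) hr.le (by positivity)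
    (g := fun _ => 1) (fun t ht => by
      have ht0 : 0 < t := hr.trans ht.1
      have e1 := rpow_block_le (s := σ - 3 / 2) hr ht.1.le ht.2
      have e2 : (2 * r + b ^ 2) ^ (-(α + 1 / 2)) ≤ (t + b ^ 2) ^ (-(α + 1 / 2)) :=
        Real.rpow_le_rpow_of_nonpos (by positivity) (by linarith [ht.2]) (by linarith)
      have e3 : c * a ^ 2 / t ≤ c * a ^ 2 / r :=
        div_le_div_of_nonneg_left (by positivity) hr ht.1.le
      have e4 : Real.exp (-(2 * r) - c * a ^ 2 / r) ≤ Real.exp (-t - c * a ^ 2 / t) :=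
        Real.exp_le_exp.2 (by linarith [ht.2])
      rw [profile, mul_one, ← mul_assoc (2 ^ (-|σ - 3 / 2|)), ← mul_assoc]
      exact mul_le_mul (mul_le_mul e4 e1 (by positivity) (by positivity)) e2 (by positivity)
        (by positivity))
  refine le_trans (le_of_eq ?_) h
  simp only [ENNReal.ofReal_one, lintegral_const, MeasurableSet.univ, Measure.restrict_apply,
    univ_inter, Real.volume_Ioc, one_mul]
  rw [← ENNReal.ofReal_mul (by positivity)]
  congr 1
  rw [show σ - 1 / 2 = σ - 3 / 2 + 1 by ring, Real.rpow_add_one hr.ne']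
  ring

/-- At σ = 1/2 the power of t is t^{-1}. On (l,u] with a² ≤ l the Gaussian is at least e^{-c} and
the weight at least B^{-α-1/2}. -/
theorem log_le_profileIntegral {α c a b l u B : ℝ} (hα : -1 / 2 < α) (hc : 0 < c) (hl : 0 < l)
    (hlu : l ≤ u) (hal : a ^ 2 ≤ l) (hB : u + b ^ 2 ≤ B) :
    ENNReal.ofReal (Real.exp (-u - c) * B ^ (-(α + 1 / 2)) * Real.log (u / l)) ≤
      profileIntegral α (1 / 2) c a b := by
  have hBpos : 0 < B := by nlinarith [sq_nonneg b]
  have h := le_profileIntegral (α := α) (σ := 1 / 2) (c := c) (a := a) (b := b) (l := l) (u := u)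
    (K := Real.exp (-u - c) * B ^ (-(α + 1 / 2))) hl.le (by positivity)
    (g := fun t => t⁻¹) (fun t ht => by
      have ht0 : 0 < t := hl.trans ht.1
      have e2 : B ^ (-(α + 1 / 2)) ≤ (t + b ^ 2) ^ (-(α + 1 / 2)) :=
        Real.rpow_le_rpow_of_nonpos (by positivity) (by linarith [ht.2]) (by linarith)
      have e3 : c * a ^ 2 / t ≤ c := by
        rw [div_le_iff₀ ht0]
        have := ht.1
        gcongr
        linarith
      have e4 : Real.exp (-u - c) ≤ Real.exp (-t - c * a ^ 2 / t) :=
        Real.exp_le_exp.2 (by linarith [ht.2])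
      rw [profile, show (1 : ℝ) / 2 - 3 / 2 = -1 by norm_num, Real.rpow_neg_one, mul_right_comm]
      gcongr)
  rwa [lintegral_Ioc_inv hl hlu, ← ENNReal.ofReal_mul (by positivity)] at h

/-- For t > b² one has t + b² ≤ 2t, so at σ = α+1 the integrand is again of size t^{-1} on (b²,1].
-/
theorem log_le_profileIntegral_critical {α σ c a b : ℝ} (hα : -1 / 2 < α) (hσ : σ = α + 1)
    (hc : 0 < c) (hb : 0 < b) (hb1 : b ≤ 1) (ha : 0 ≤ a) (hab : a ≤ b) :
    ENNReal.ofReal (Real.exp (-1 - c) * 2 ^ (-(α + 1 / 2)) * Real.log (1 / b ^ 2)) ≤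
      profileIntegral α σ c a b := by
  have h := le_profileIntegral (α := α) (σ := σ) (c := c) (a := a) (b := b) (l := b ^ 2) (u := 1)
    (K := Real.exp (-1 - c) * 2 ^ (-(α + 1 / 2))) (by positivity) (by positivity)
    (g := fun t => t⁻¹) (fun t ht => by
      have ht0 : 0 < t := (by positivity : 0 < b ^ 2).trans ht.1
      have e2 : (2 * t) ^ (-(α + 1 / 2)) ≤ (t + b ^ 2) ^ (-(α + 1 / 2)) :=
        Real.rpow_le_rpow_of_nonpos (by positivity) (by linarith [ht.1]) (by linarith)
      have e3 : c * a ^ 2 / t ≤ c := by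
        rw [div_le_iff₀ ht0]
        have := ht.1
        have : a ^ 2 ≤ t := by nlinarith
        gcongr
      have e4 : Real.exp (-1 - c) ≤ Real.exp (-t - c * a ^ 2 / t) :=
        Real.exp_le_exp.2 (by linarith [ht.2])
      rw [Real.mul_rpow two_pos.le ht0.le] at e2
      have e5 : t⁻¹ = t ^ (σ - 3 / 2) * t ^ (-(α + 1 / 2)) := by
        rw [← Real.rpow_add ht0, ← Real.rpow_neg_one]
        congr 1
        rw [hσ]; ring
      rw [profile, e5]
      calc _ = Real.exp (-1 - c) * t ^ (σ - 3 / 2) *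
            (2 ^ (-(α + 1 / 2)) * t ^ (-(α + 1 / 2))) := by ring
        _ ≤ _ := by gcongr)
  rwa [lintegral_Ioc_inv (by positivity) (by nlinarith), ← ENNReal.ofReal_mul (by positivity)] at h

/-- With a = 0 there is no Gaussian cutoff, and t^{σ-3/2} is not integrable at 0. -/
theorem profileIntegral_zero_eq_top {α σ c b : ℝ} (hα : -1 / 2 < α) (hσ : σ ≤ 1 / 2) (hb : 0 < b) :
    profileIntegral α σ c 0 b = ⊤ := by
  have h := le_profileIntegral (α := α) (σ := σ) (c := c) (a := 0) (b := b) (l := 0) (u := 1)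
    (K := Real.exp (-1) * (1 + b ^ 2) ^ (-(α + 1 / 2))) le_rfl (by positivity)
    (g := fun t => t ^ (σ - 3 / 2)) (fun t ht => by
      have ht0 : 0 < t := ht.1
      have e2 : (1 + b ^ 2) ^ (-(α + 1 / 2)) ≤ (t + b ^ 2) ^ (-(α + 1 / 2)) :=
        Real.rpow_le_rpow_of_nonpos (by positivity) (by linarith [ht.2]) (by linarith)
      have e4 : Real.exp (-1) ≤ Real.exp (-t - c * 0 ^ 2 / t) :=
        Real.exp_le_exp.2 (by simpa using ht.2)
      rw [profile, mul_right_comm]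
      gcongr)
  rw [lintegral_rpow_eq_top (by linarith) one_pos, ENNReal.mul_top (by simp; positivity)] at h
  exact top_le_iff.1 h

theorem profileIntegral_zero_zero_eq_top {α σ c : ℝ} (hσ : σ ≤ α + 1) :
    profileIntegral α σ c 0 0 = ⊤ := by
  have h := le_profileIntegral (α := α) (σ := σ) (c := c) (a := 0) (b := 0) (l := 0) (u := 1)
    (K := Real.exp (-1)) le_rfl (by positivity)
    (g := fun t => t ^ (σ - α - 2)) (fun t ht => by
      have ht0 : 0 < t := ht.1
      have e4 : Real.exp (-1) ≤ Real.exp (-t) := Real.exp_le_exp.2 (by linarith [ht.2])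
      rw [profile_eq ht0]
      simpa using mul_le_mul_of_nonneg_right e4 (by positivity))
  rw [lintegral_rpow_eq_top (by linarith) one_pos, ENNReal.mul_top (by simp; positivity)] at h
  exact top_le_iff.1 h

/-! ### Lower bounds for the model integral. -/

theorem epow_of_pos {s : ℝ} (hs : 0 < s) (β : ℝ) : epow s β = ENNReal.ofReal (s ^ β) := by
  rw [epow, ENNReal.ofReal_rpow_of_pos hs]

theorem elogRatio_of_le {a b : ℝ} (hb : 0 < b) (hab : b ≤ a) :
    elogRatio a b = ENNReal.ofReal (Real.log (a / b)) := by
  have h := (one_le_div hb).2 hab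
  rw [elogRatio, if_neg hb.ne', Real.posLog_eq_log]
  rwa [abs_of_nonneg (by linarith)]

theorem ofReal_le_inv_mul {k X : ℝ} {I : ℝ≥0∞} (hk : 0 < k) (h : ENNReal.ofReal (k * X) ≤ I) :
    ENNReal.ofReal X ≤ ENNReal.ofReal k⁻¹ * I := by
  calc ENNReal.ofReal X = ENNReal.ofReal k⁻¹ * ENNReal.ofReal (k * X) := by
        rw [← ENNReal.ofReal_mul (by positivity), inv_mul_cancel_left₀ hk.ne']
    _ ≤ _ := by gcongr

theorem le_mul_of_eq_top {K : ℝ} {X I : ℝ≥0∞} (hK : 0 < K) (h : I = ⊤) :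
    X ≤ ENNReal.ofReal K * I := by
  rw [h, ENNReal.mul_top (by simpa using hK)]
  exact le_top

/-- The right-hand side of the local estimates as a function of `a = |x - y|`, `b = |x| + |y|`. -/
noncomputable def localBound (α σ a b : ℝ) : ℝ≥0∞ :=
  ((if α + 1 < σ then 1 else 0) + (if σ = α + 1 then elogRatio 1 b else 0)) +
    if σ < 1 / 2 then epow b (-2 * α - 1) * epow a (2 * σ - 1)
    else if σ = 1 / 2 then epow b (-2 * α - 1) * elogRatio (2 * b) a
    else epow b (2 * σ - 2 * α - 2)

/-- The block [1,2], on which every factor is bounded below when a ≤ b ≤ 1. -/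
theorem exists_one_le_profileIntegral {α σ c : ℝ} (hα : -1 / 2 < α) (hc : 0 < c) :
    ∃ K : ℝ, 0 < K ∧ ∀ a b : ℝ, 0 ≤ a → a ≤ b → b ≤ 1 →
      1 ≤ ENNReal.ofReal K * profileIntegral α σ c a b := by
  set k : ℝ := Real.exp (-2 - c) * (2 ^ (-|σ - 3 / 2|) * 3 ^ (-(α + 1 / 2))) with hk
  have hkpos : 0 < k := by positivity
  refine ⟨k⁻¹, by positivity, fun a b ha hab hb => ?_⟩
  rw [← ENNReal.ofReal_one]
  refine ofReal_le_inv_mul hkpos (le_trans (ENNReal.ofReal_le_ofReal ?_)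
    (block_le_profileIntegral hα hc one_pos))
  rw [hk, mul_one, Real.one_rpow, one_mul]
  have e1 : (3 : ℝ) ^ (-(α + 1 / 2)) ≤ (2 * 1 + b ^ 2) ^ (-(α + 1 / 2)) :=
    Real.rpow_le_rpow_of_nonpos (by positivity) (by nlinarith) (by linarith)
  have e2 : Real.exp (-2 - c) ≤ Real.exp (-(2 * 1) - c * a ^ 2 / 1) := by
    refine Real.exp_le_exp.2 ?_
    have : a ^ 2 ≤ 1 := by nlinarith
    have : c * a ^ 2 ≤ c * 1 := by gcongr
    linarith
  gcongr

/-- The block [b²,2b²]: there ca²/t ≤ c because a ≤ b, and t + b² ≤ 3b². -/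
theorem exists_rpow_le_profileIntegral {α σ c : ℝ} (hα : -1 / 2 < α) (hc : 0 < c) :
    ∃ K : ℝ, 0 < K ∧ ∀ a b : ℝ, 0 ≤ a → a ≤ b → 0 < b → b ≤ 1 →
      epow b (2 * σ - 2 * α - 2) ≤ ENNReal.ofReal K * profileIntegral α σ c a b := by
  set k : ℝ := Real.exp (-2 - c) * (2 ^ (-|σ - 3 / 2|) * 3 ^ (-(α + 1 / 2))) with hk
  have hkpos : 0 < k := by positivity
  refine ⟨k⁻¹, by positivity, fun a b ha hab hb0 hb => ?_⟩
  rw [epow_of_pos hb0]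
  refine ofReal_le_inv_mul hkpos (le_trans (ENNReal.ofReal_le_ofReal ?_)
    (block_le_profileIntegral hα hc (show 0 < b ^ 2 by positivity)))
  have e2 : Real.exp (-2 - c) ≤ Real.exp (-(2 * b ^ 2) - c * a ^ 2 / b ^ 2) := by
    refine Real.exp_le_exp.2 ?_
    have : c * a ^ 2 / b ^ 2 ≤ c := by
      rw [div_le_iff₀ (by positivity)]
      gcongr
    nlinarith
  have e3 : b ^ (2 * σ - 2 * α - 2) = (b ^ 2) ^ (σ - 1 / 2) * (b ^ 2) ^ (-(α + 1 / 2)) := by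
    rw [← Real.rpow_add (by positivity), sq_rpow hb0.le]
    congr 1
    ring
  rw [show 2 * b ^ 2 + b ^ 2 = 3 * b ^ 2 by ring, Real.mul_rpow (by norm_num) (by positivity),
    hk, e3]
  calc _ = Real.exp (-2 - c) * (2 ^ (-|σ - 3 / 2|) *
        ((b ^ 2) ^ (σ - 1 / 2) * (3 ^ (-(α + 1 / 2)) * (b ^ 2) ^ (-(α + 1 / 2))))) := by ring
    _ ≤ _ := by gcongr

/-- The block `[a², 2a²]`. -/
theorem exists_near_le_profileIntegral {α σ c : ℝ} (hα : -1 / 2 < α) (hσ : σ < 1 / 2) (hc : 0 < c) :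
    ∃ K : ℝ, 0 < K ∧ ∀ a b : ℝ, 0 ≤ a → a ≤ b → 0 < b → a ≤ 1 →
      epow b (-2 * α - 1) * epow a (2 * σ - 1) ≤
        ENNReal.ofReal K * profileIntegral α σ c a b := by
  set k : ℝ := Real.exp (-2 - c) * (2 ^ (-|σ - 3 / 2|) * 3 ^ (-(α + 1 / 2))) with hk
  have hkpos : 0 < k := by positivity
  refine ⟨k⁻¹, by positivity, fun a b ha hab hb0 ha1 => ?_⟩
  rcases ha.eq_or_lt with rfl | ha0
  · exact le_mul_of_eq_top (by positivity) (profileIntegral_zero_eq_top hα hσ.le hb0)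
  rw [epow_of_pos hb0, epow_of_pos ha0, ← ENNReal.ofReal_mul (by positivity)]
  refine ofReal_le_inv_mul hkpos (le_trans (ENNReal.ofReal_le_ofReal ?_)
    (block_le_profileIntegral hα hc (show 0 < a ^ 2 by positivity)))
  have e1 : (3 * b ^ 2) ^ (-(α + 1 / 2)) ≤ (2 * a ^ 2 + b ^ 2) ^ (-(α + 1 / 2)) :=
    Real.rpow_le_rpow_of_nonpos (by positivity) (by nlinarith) (by linarith)
  have e2 : Real.exp (-2 - c) ≤ Real.exp (-(2 * a ^ 2) - c * a ^ 2 / a ^ 2) := by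
    refine Real.exp_le_exp.2 ?_
    rw [mul_div_assoc, div_self (by positivity), mul_one]
    nlinarith
  have e3 : a ^ (2 * σ - 1) = (a ^ 2) ^ (σ - 1 / 2) := by
    rw [sq_rpow ha0.le]; congr 1; ring
  have e4 : b ^ (-2 * α - 1) = (b ^ 2) ^ (-(α + 1 / 2)) := by
    rw [sq_rpow hb0.le]; congr 1; ring
  rw [Real.mul_rpow (by norm_num) (by positivity)] at e1
  rw [hk, e3, e4]
  calc _ = Real.exp (-2 - c) * (2 ^ (-|σ - 3 / 2|) *
        ((a ^ 2) ^ (σ - 1 / 2) * (3 ^ (-(α + 1 / 2)) * (b ^ 2) ^ (-(α + 1 / 2))))) := by ring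
    _ ≤ _ := by gcongr

theorem exists_localBound_le {α σ c : ℝ} (hα : -1 / 2 < α) (hc : 0 < c) :
    ∃ K : ℝ, 0 < K ∧ ∀ a b : ℝ, 0 ≤ a → a ≤ b → b ≤ 1 →
      localBound α σ a b ≤ ENNReal.ofReal K * profileIntegral α σ c a b := by
  obtain ⟨K₁, hK₁, h₁⟩ := exists_one_le_profileIntegral (σ := σ) hα hc
  have hcommon : ∃ K : ℝ, 0 < K ∧ ∀ a b : ℝ, 0 ≤ a → a ≤ b → b ≤ 1 →
      (if σ = α + 1 then elogRatio 1 b else 0) ≤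
        ENNReal.ofReal K * profileIntegral α σ c a b := by
    set k : ℝ := 2 * (Real.exp (-1 - c) * 2 ^ (-(α + 1 / 2))) with hk
    have hkpos : 0 < k := by positivity
    refine ⟨k⁻¹, by positivity, fun a b ha hab hb => ?_⟩
    split_ifs with h
    · rcases (ha.trans hab).eq_or_lt with rfl | hb0
      · obtain rfl : a = 0 := le_antisymm hab ha
        exact le_mul_of_eq_top (by positivity) (profileIntegral_zero_zero_eq_top h.le)
      · rw [elogRatio_of_le hb0 hb]
        refine ofReal_le_inv_mul hkpos (le_trans (ENNReal.ofReal_le_ofReal (le_of_eq ?_))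
          (log_le_profileIntegral_critical hα h hc hb0 hb ha hab))
        rw [hk, show 1 / b ^ 2 = (1 / b) ^ 2 by ring, Real.log_pow]
        push_cast
        ring
    · exact zero_le
  have hmain : ∃ K : ℝ, 0 < K ∧ ∀ a b : ℝ, 0 ≤ a → a ≤ b → b ≤ 1 →
      (if σ < 1 / 2 then epow b (-2 * α - 1) * epow a (2 * σ - 1)
        else if σ = 1 / 2 then epow b (-2 * α - 1) * elogRatio (2 * b) a
        else epow b (2 * σ - 2 * α - 2)) ≤
        ENNReal.ofReal K * profileIntegral α σ c a b := by
    rcases lt_trichotomy σ (1 / 2) with h | h | h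
    · obtain ⟨K, hK, hle⟩ := exists_near_le_profileIntegral hα h hc
      refine ⟨K, hK, fun a b ha hab hb => ?_⟩
      rw [if_pos h]
      rcases (ha.trans hab).eq_or_lt with rfl | hb0
      · obtain rfl : a = 0 := le_antisymm hab ha
        exact le_mul_of_eq_top hK (profileIntegral_zero_zero_eq_top (by linarith))
      · exact hle a b ha hab hb0 (hab.trans hb)
    · set k : ℝ := 2 * (Real.exp (-4 - c) * 5 ^ (-(α + 1 / 2))) with hk
      have hkpos : 0 < k := by positivity
      refine ⟨k⁻¹, by positivity, fun a b ha hab hb => ?_⟩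
      rw [if_neg (by linarith), if_pos h]
      rcases (ha.trans hab).eq_or_lt with rfl | hb0
      · obtain rfl : a = 0 := le_antisymm hab ha
        exact le_mul_of_eq_top (by positivity) (profileIntegral_zero_zero_eq_top (by linarith))
      rcases ha.eq_or_lt with rfl | ha0
      · exact le_mul_of_eq_top (by positivity) (profileIntegral_zero_eq_top hα h.le hb0)
      have hlog := Real.log_nonneg ((one_le_div ha0).2 (show a ≤ 2 * b by linarith))
      rw [epow_of_pos hb0, elogRatio_of_le ha0 (by linarith), ← ENNReal.ofReal_mul (by positivity),
        h]
      -- The range [a²,4b²] is chosen so that its logarithmic length is exactly 2 log(2b/a),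
      -- positive even when a = b.
      refine ofReal_le_inv_mul hkpos (le_trans (ENNReal.ofReal_le_ofReal ?_)
          (log_le_profileIntegral hα hc (l := a ^ 2) (u := 4 * b ^ 2) (B := 5 * b ^ 2)
            (by positivity) (by nlinarith) le_rfl (by linarith)))
      have e4 : b ^ (-2 * α - 1) = (b ^ 2) ^ (-(α + 1 / 2)) := by
        rw [sq_rpow hb0.le]; congr 1; ring
      have e5 : Real.log (4 * b ^ 2 / a ^ 2) = 2 * Real.log (2 * b / a) := by
        rw [show 4 * b ^ 2 / a ^ 2 = (2 * b / a) ^ 2 by ring, Real.log_pow]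
        push_cast
        ring
      have e6 : Real.exp (-4 - c) ≤ Real.exp (-(4 * b ^ 2) - c) :=
        Real.exp_le_exp.2 (by nlinarith)
      rw [hk, e4, e5, Real.mul_rpow (by norm_num) (by positivity)]
      calc _ = Real.exp (-4 - c) * (5 ^ (-(α + 1 / 2)) * (b ^ 2) ^ (-(α + 1 / 2))) *
            (2 * Real.log (2 * b / a)) := by ring
        _ ≤ _ := by gcongr
    · obtain ⟨K, hK, hle⟩ := exists_rpow_le_profileIntegral (σ := σ) hα hc
      refine ⟨K + K₁, by positivity, fun a b ha hab hb => ?_⟩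
      rw [if_neg (by linarith), if_neg (by linarith)]
      rcases (ha.trans hab).eq_or_lt with rfl | hb0
      · obtain rfl : a = 0 := le_antisymm hab ha
        rcases le_or_gt σ (α + 1) with h2 | h2
        · exact le_mul_of_eq_top (by positivity) (profileIntegral_zero_zero_eq_top h2)
        · rw [epow, ENNReal.ofReal_zero, ENNReal.zero_rpow_of_pos (by linarith)]
          exact zero_le
      · refine (hle a b ha hab hb0 hb).trans ?_
        gcongr
        linarith
  obtain ⟨K₂, hK₂, h₂⟩ := hcommon
  obtain ⟨K₃, hK₃, h₃⟩ := hmain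
  refine ⟨K₁ + K₂ + K₃, by positivity, fun a b ha hab hb => ?_⟩
  rw [localBound, ENNReal.ofReal_add (by positivity) hK₃.le, ENNReal.ofReal_add hK₁.le hK₂.le,
    add_mul, add_mul]
  refine add_le_add (add_le_add ?_ (h₂ a b ha hab hb)) (h₃ a b ha hab hb)
  split_ifs
  · exact h₁ a b ha hab hb
  · exact zero_le

/-- The right-hand side of the global estimates, without the exponential factor. -/
noncomputable def globalBound (α σ a b : ℝ) : ℝ≥0∞ :=
  epow b (-2 * α - 1) *
    (if σ < 1 / 2 then epow a (2 * σ - 1)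
     else if σ = 1 / 2 then 1 + elogRatio 1 a
     else 1)

theorem exists_exp_le_profileIntegral {α σ c : ℝ} (hα : -1 / 2 < α) (hσ : 0 < σ) (hc : 0 < c) :
    ∃ K : ℝ, 0 < K ∧ ∀ a b : ℝ, 0 ≤ a → a ≤ b → 1 < b →
      epow b (-2 * α - 1) * ENNReal.ofReal (Real.exp (-(3 + c) * a)) ≤
        ENNReal.ofReal K * profileIntegral α σ c a b := by
  set k : ℝ := Real.exp (-3) * (2 ^ (-|σ - 3 / 2|) * 3 ^ (-(α + 1 / 2))) with hk
  have hkpos : 0 < k := by positivity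
  refine ⟨k⁻¹, by positivity, fun a b ha hab hb => ?_⟩
  have hb0 : 0 < b := by linarith
  -- On the block [r,2r] the exponent costs 2r + ca²/r ≤ 2r + ca, and r^{σ-1/2} ≥ e^{-r}. In total
  -- 3r + ca ≤ 3 + (3+c)a, whence the rate 3 + c.
  set r := max 1 a with hr
  have hr1 : 1 ≤ r := le_max_left _ _
  have hra : a ≤ r := le_max_right _ _
  have hrb : r ≤ b := max_le hb.le hab
  have hr2 : r ≤ 1 + a := max_le (by linarith) (by linarith)
  rw [epow_of_pos hb0, ← ENNReal.ofReal_mul (by positivity)]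
  refine ofReal_le_inv_mul hkpos (le_trans (ENNReal.ofReal_le_ofReal ?_)
    (block_le_profileIntegral hα hc (show 0 < r by linarith)))
  have e1 : (3 * b ^ 2) ^ (-(α + 1 / 2)) ≤ (2 * r + b ^ 2) ^ (-(α + 1 / 2)) :=
    Real.rpow_le_rpow_of_nonpos (by positivity) (by nlinarith) (by linarith)
  have e3 : Real.exp (-r) ≤ r ^ (σ - 1 / 2) := by
    calc Real.exp (-r) = (Real.exp r)⁻¹ := Real.exp_neg r
      _ ≤ r⁻¹ := by
        gcongr
        linarith [Real.add_one_le_exp r]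
      _ = r ^ (-1 : ℝ) := (Real.rpow_neg_one r).symm
      _ ≤ r ^ (σ - 1 / 2) := Real.rpow_le_rpow_of_exponent_le hr1 (by linarith)
  have e2 : Real.exp (-3) * Real.exp (-(3 + c) * a) ≤
      Real.exp (-(2 * r) - c * a ^ 2 / r) * Real.exp (-r) := by
    rw [← Real.exp_add, ← Real.exp_add]
    refine Real.exp_le_exp.2 ?_
    have : c * a ^ 2 / r ≤ c * a := by
      rw [div_le_iff₀ (by positivity), pow_two, ← mul_assoc]
      gcongr
    linarith
  have e4 : b ^ (-2 * α - 1) = (b ^ 2) ^ (-(α + 1 / 2)) := by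
    rw [sq_rpow hb0.le]; congr 1; ring
  rw [Real.mul_rpow (by norm_num) (by positivity)] at e1
  rw [hk, e4]
  calc _ = 2 ^ (-|σ - 3 / 2|) * ((Real.exp (-3) * Real.exp (-(3 + c) * a)) *
        (3 ^ (-(α + 1 / 2)) * (b ^ 2) ^ (-(α + 1 / 2)))) := by ring
    _ ≤ 2 ^ (-|σ - 3 / 2|) * ((Real.exp (-(2 * r) - c * a ^ 2 / r) * Real.exp (-r)) *
        (2 * r + b ^ 2) ^ (-(α + 1 / 2))) := by gcongr
    _ = Real.exp (-(2 * r) - c * a ^ 2 / r) * (2 ^ (-|σ - 3 / 2|) *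
        (Real.exp (-r) * (2 * r + b ^ 2) ^ (-(α + 1 / 2)))) := by ring
    _ ≤ _ := by gcongr

theorem exists_globalBound_le {α σ c : ℝ} (hα : -1 / 2 < α) (hσ : 0 < σ) (hc : 0 < c) :
    ∃ K : ℝ, 0 < K ∧ ∀ a b : ℝ, 0 ≤ a → a ≤ b → 1 < b →
      globalBound α σ a b * ENNReal.ofReal (Real.exp (-(3 + c) * a)) ≤
        ENNReal.ofReal K * profileIntegral α σ c a b := by
  obtain ⟨K₁, hK₁, h₁⟩ := exists_exp_le_profileIntegral hα hσ hc
  have hexp : ∀ a : ℝ, 0 ≤ a → ENNReal.ofReal (Real.exp (-(3 + c) * a)) ≤ 1 := fun a ha => by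
    rw [← ENNReal.ofReal_one]
    refine ENNReal.ofReal_le_ofReal (Real.exp_le_one_iff.2 ?_)
    rw [neg_mul]
    exact neg_nonpos.2 (by positivity)
  rcases lt_trichotomy σ (1 / 2) with h | h | h
  · obtain ⟨K₂, hK₂, h₂⟩ := exists_near_le_profileIntegral hα h hc
    refine ⟨K₁ + K₂, by positivity, fun a b ha hab hb => ?_⟩
    rw [globalBound, if_pos h]
    -- For a ≤ 1 the block [a²,2a²] suffices; for a > 1 the power a^{2σ-1} is at most 1, and the
    -- purely exponential bound takes over.
    rcases le_or_gt a 1 with ha1 | ha1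
    · calc _ ≤ epow b (-2 * α - 1) * epow a (2 * σ - 1) * 1 := by gcongr; exact hexp a ha
        _ ≤ ENNReal.ofReal K₂ * profileIntegral α σ c a b := by
          rw [mul_one]; exact h₂ a b ha hab (by linarith) ha1
        _ ≤ _ := by gcongr; linarith
    · have e : epow a (2 * σ - 1) ≤ 1 := by
        rw [epow_of_pos (by linarith), ← ENNReal.ofReal_one]
        exact ENNReal.ofReal_le_ofReal
          (Real.rpow_le_one_of_one_le_of_nonpos ha1.le (by linarith))
      calc _ ≤ epow b (-2 * α - 1) * 1 * ENNReal.ofReal (Real.exp (-(3 + c) * a)) := by gcongr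
        _ ≤ ENNReal.ofReal K₁ * profileIntegral α σ c a b := by
          rw [mul_one]; exact h₁ a b ha hab hb
        _ ≤ _ := by gcongr; linarith
  · set k : ℝ := 2 * (Real.exp (-1 - c) * 2 ^ (-(α + 1 / 2))) with hk
    have hkpos : 0 < k := by positivity
    refine ⟨K₁ + k⁻¹, by positivity, fun a b ha hab hb => ?_⟩
    have hb0 : 0 < b := by linarith
    rw [globalBound, if_neg (by linarith), if_pos h, mul_add, mul_one, add_mul,
      ENNReal.ofReal_add (by positivity) (by positivity), add_mul]
    refine add_le_add (h₁ a b ha hab hb) ?_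
    rcases ha.eq_or_lt with rfl | ha0
    · exact le_mul_of_eq_top (by positivity) (profileIntegral_zero_eq_top hα h.le hb0)
    rcases le_or_gt a 1 with ha1 | ha1
    · have hlog := Real.log_nonneg ((one_le_div ha0).2 ha1)
      calc _ ≤ epow b (-2 * α - 1) * elogRatio 1 a * 1 := by gcongr; exact hexp a ha
        _ ≤ _ := by
          rw [mul_one, epow_of_pos hb0, elogRatio_of_le ha0 ha1,
            ← ENNReal.ofReal_mul (by positivity), h]
          refine ofReal_le_inv_mul hkpos (le_trans (ENNReal.ofReal_le_ofReal (le_of_eq ?_))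
            (log_le_profileIntegral hα hc (l := a ^ 2) (u := 1) (B := 2 * b ^ 2)
              (by positivity) (by nlinarith) le_rfl (by nlinarith)))
          have e4 : b ^ (-2 * α - 1) = (b ^ 2) ^ (-(α + 1 / 2)) := by
            rw [sq_rpow hb0.le]; congr 1; ring
          rw [hk, e4, Real.mul_rpow (by norm_num) (by positivity),
            show 1 / a ^ 2 = (1 / a) ^ 2 by ring, Real.log_pow]
          push_cast
          ring
    · have : elogRatio 1 a = 0 := by
        rw [elogRatio, if_neg ha0.ne', ENNReal.ofReal_eq_zero]
        refine le_of_eq (Real.posLog_eq_zero_iff _ |>.2 ?_)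
        rw [abs_of_pos (by positivity), div_le_one ha0]
        exact ha1.le
      rw [this, mul_zero, zero_mul]
      exact zero_le
  · refine ⟨K₁, hK₁, fun a b ha hab hb => ?_⟩
    rw [globalBound, if_neg (by linarith), if_neg (by linarith), mul_one]
    exact h₁ a b ha hab hb

/-! ### Upper bounds for the model integral. -/

/-- From e^{-v} ≤ 1/v. The one power of t gained makes t^s integrable at 0 for s > -2, enough for s
= σ - 3/2 with σ > 0. -/
theorem exp_neg_div_le {c a t : ℝ} (hc : 0 < c) (ha : 0 < a) (ht : 0 < t) :
    Real.exp (-(c * a ^ 2 / t)) ≤ (c * a ^ 2)⁻¹ * t := by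
  have h : 0 < c * a ^ 2 / t := by positivity
  have e : (c * a ^ 2)⁻¹ * t = (c * a ^ 2 / t)⁻¹ := by field_simp
  rw [Real.exp_neg, e]
  gcongr
  linarith [Real.add_one_le_exp (c * a ^ 2 / t)]

/-- The part `t ≤ a²` of the model integral. -/
theorem lintegral_near_le {c a s : ℝ} (hc : 0 < c) (ha : 0 < a) (hs : -2 < s) :
    ∫⁻ t in Ioc 0 (a ^ 2), ENNReal.ofReal (Real.exp (-(c * a ^ 2 / t)) * t ^ s) ≤
      ENNReal.ofReal ((c * (s + 2))⁻¹ * a ^ (2 * s + 2)) := by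
  calc _ ≤ ∫⁻ t in Ioc 0 (a ^ 2),
        ENNReal.ofReal (c * a ^ 2)⁻¹ * ENNReal.ofReal (t ^ (s + 1)) := by
        refine setLIntegral_mono' measurableSet_Ioc fun t ht => ?_
        have ht0 : 0 < t := ht.1
        rw [← ENNReal.ofReal_mul (by positivity)]
        refine ENNReal.ofReal_le_ofReal ?_
        rw [Real.rpow_add_one ht0.ne', mul_comm (t ^ s), ← mul_assoc]
        exact mul_le_mul_of_nonneg_right (exp_neg_div_le hc ha ht0) (by positivity)
    _ = _ := by
        rw [lintegral_const_mul' _ _ ENNReal.ofReal_ne_top,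
          lintegral_Ioc_rpow (by linarith) (by positivity), ← ENNReal.ofReal_mul (by positivity),
          sq_rpow ha.le]
        congr 1
        rw [show 2 * (s + 1 + 1) = 2 * s + 2 + 2 by ring, Real.rpow_add ha _ 2, Real.rpow_two,
          show s + 1 + 1 = s + 2 by ring]
        have : s + 2 ≠ 0 := by linarith
        field_simp

/-- Split at t = a²: the Gaussian controls the part below, and t^s is integrable at infinity since s
< -1. Both parts scale as a^{2s+2}. -/
theorem exists_lintegral_subcritical_le {c s : ℝ} (hc : 0 < c) (hs : -2 < s) (hs' : s < -1) :
    ∃ M : ℝ, 0 < M ∧ ∀ a : ℝ, 0 < a →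
      ∫⁻ t in Ioi 0, ENNReal.ofReal (Real.exp (-(c * a ^ 2 / t)) * t ^ s) ≤
        ENNReal.ofReal M * epow a (2 * s + 2) := by
  have h1 : 0 < s + 2 := by linarith
  have h2 : 0 < -(s + 1) := by linarith
  refine ⟨(c * (s + 2))⁻¹ + (-(s + 1))⁻¹, by positivity, fun a ha => ?_⟩
  rw [← Ioc_union_Ioi_eq_Ioi (show (0 : ℝ) ≤ a ^ 2 by positivity), epow_of_pos ha,
    ENNReal.ofReal_add (by positivity) (by positivity), add_mul,
    ← ENNReal.ofReal_mul (by positivity), ← ENNReal.ofReal_mul (by positivity)]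
  refine (lintegral_union_le _ _ _).trans (add_le_add (lintegral_near_le hc ha hs) ?_)
  calc _ ≤ ∫⁻ t in Ioi (a ^ 2), ENNReal.ofReal (t ^ s) := by
        refine setLIntegral_mono' measurableSet_Ioi fun t ht => ENNReal.ofReal_le_ofReal ?_
        have ht0 : 0 < t := lt_of_le_of_lt (by positivity) ht
        exact mul_le_of_le_one_left (by positivity)
          (Real.exp_le_one_iff.2 (neg_nonpos.2 (by positivity)))
    _ = _ := by
        rw [lintegral_Ioi_rpow hs' (by positivity), sq_rpow ha.le]
        congr 1
        rw [show 2 * (s + 1) = 2 * s + 2 by ring]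
        ring

/-- The logarithm is the mass of t^{-1} up to max(l,1); the constant 2 is the integral of e^{-t/2}
over the half-line. -/
theorem lintegral_tail_le {l : ℝ} (hl : 0 < l) :
    ∫⁻ t in Ioi l, ENNReal.ofReal (Real.exp (-(t / 2)) * t⁻¹) ≤
      ENNReal.ofReal (Real.posLog (1 / l) + 2) := by
  have hsub : Ioi l ⊆ Ioc l (max l 1) ∪ Ioi 1 := fun t ht => by
    rcases le_or_gt t 1 with h | h
    · exact Or.inl ⟨ht, h.trans (le_max_right _ _)⟩
    · exact Or.inr h
  rw [ENNReal.ofReal_add Real.posLog_nonneg (by norm_num)]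
  refine (lintegral_mono_set hsub).trans ((lintegral_union_le _ _ _).trans (add_le_add ?_ ?_))
  · calc _ ≤ ∫⁻ t in Ioc l (max l 1), ENNReal.ofReal (t⁻¹) := by
          refine setLIntegral_mono' measurableSet_Ioc fun t ht => ENNReal.ofReal_le_ofReal ?_
          have ht0 : 0 < t := hl.trans ht.1
          exact mul_le_of_le_one_left (by positivity)
            (Real.exp_le_one_iff.2 (neg_nonpos.2 (by positivity)))
      _ ≤ _ := by
          rw [lintegral_Ioc_inv hl (le_max_left _ _)]
          refine ENNReal.ofReal_le_ofReal ?_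
          rcases le_total l 1 with h | h
          · rw [max_eq_right h]
            exact le_max_right _ _
          · rw [max_eq_left h, div_self hl.ne', Real.log_one]
            exact Real.posLog_nonneg
  · calc _ ≤ ∫⁻ t in Ioi (1 : ℝ), ENNReal.ofReal (t ^ ((1 : ℝ) - 1) * Real.exp (-(1 / 2 * t))) := by
          refine setLIntegral_mono' measurableSet_Ioi fun t ht => ENNReal.ofReal_le_ofReal ?_
          have ht1 : 1 < t := ht
          rw [sub_self, Real.rpow_zero, one_mul, show t / 2 = 1 / 2 * t by ring]
          exact mul_le_of_le_one_right (by positivity) (inv_le_one_of_one_le₀ ht1.le)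
      _ ≤ ∫⁻ t in Ioi (0 : ℝ), ENNReal.ofReal (t ^ ((1 : ℝ) - 1) * Real.exp (-(1 / 2 * t))) :=
          lintegral_mono_set (Ioi_subset_Ioi zero_le_one)
      _ = _ := by
          rw [lintegral_Ioi_exp_rpow one_pos (by norm_num)]
          norm_num

theorem profile_le_small {α σ c a b t : ℝ} (hα : -1 / 2 < α) (ht : 0 < t) (hb : 0 < b) :
    profile α σ c a b t ≤ b ^ (-2 * α - 1) * (Real.exp (-t) * (Real.exp (-(c * a ^ 2 / t)) *
      t ^ (σ - 3 / 2))) := by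
  have e1 : (t + b ^ 2) ^ (-(α + 1 / 2)) ≤ (b ^ 2) ^ (-(α + 1 / 2)) :=
    Real.rpow_le_rpow_of_nonpos (by positivity) (by linarith) (by linarith)
  have e4 : b ^ (-2 * α - 1) = (b ^ 2) ^ (-(α + 1 / 2)) := by
    rw [sq_rpow hb.le]; congr 1; ring
  rw [profile, e4, sub_eq_add_neg (-t), Real.exp_add]
  calc _ ≤ Real.exp (-t) * Real.exp (-(c * a ^ 2 / t)) * t ^ (σ - 3 / 2) *
        (b ^ 2) ^ (-(α + 1 / 2)) := by gcongr
    _ = _ := by ring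

theorem profile_le_large {α σ c a b t : ℝ} (hα : -1 / 2 < α) (hc : 0 < c) (ht : 0 < t) :
    profile α σ c a b t ≤ Real.exp (-t) * t ^ (σ - α - 2) := by
  rw [profile_eq ht]
  have e1 : (1 + b ^ 2 / t) ^ (-(α + 1 / 2)) ≤ 1 :=
    Real.rpow_le_one_of_one_le_of_nonpos (by linarith [show 0 ≤ b ^ 2 / t by positivity])
      (by linarith)
  have e2 : Real.exp (-(c * a ^ 2 / t)) ≤ 1 :=
    Real.exp_le_one_iff.2 (neg_nonpos.2 (by positivity))
  calc _ ≤ Real.exp (-t) * (t ^ (σ - α - 2) * 1 * 1) := by gcongr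
    _ = _ := by ring

/-- At t = b² the larger summand in t + b² changes: bound the sum below by b² for smaller t and by t
for larger t. -/
theorem profileIntegral_le_add {α σ c a b : ℝ} (hα : -1 / 2 < α) (hc : 0 < c) (hb : 0 < b) :
    profileIntegral α σ c a b ≤ epow b (-2 * α - 1) *
      (∫⁻ t in Ioc 0 (b ^ 2), ENNReal.ofReal (Real.exp (-(c * a ^ 2 / t)) * t ^ (σ - 3 / 2))) +
      ∫⁻ t in Ioi (b ^ 2), ENNReal.ofReal (Real.exp (-t) * t ^ (σ - α - 2)) := by
  rw [profileIntegral, ← Ioc_union_Ioi_eq_Ioi (show (0 : ℝ) ≤ b ^ 2 by positivity),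
    epow_of_pos hb, ← lintegral_const_mul' _ _ ENNReal.ofReal_ne_top]
  refine (lintegral_union_le _ _ _).trans (add_le_add ?_ ?_)
  · refine setLIntegral_mono' measurableSet_Ioc fun t ht => ?_
    have ht0 : 0 < t := ht.1
    rw [← ENNReal.ofReal_mul (by positivity)]
    refine ENNReal.ofReal_le_ofReal ((profile_le_small hα ht0 hb).trans ?_)
    refine mul_le_mul_of_nonneg_left ?_ (by positivity)
    exact mul_le_of_le_one_left (by positivity) (Real.exp_le_one_iff.2 (by linarith))
  · refine setLIntegral_mono' measurableSet_Ioi fun t ht => ENNReal.ofReal_le_ofReal ?_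
    exact profile_le_large hα hc (lt_of_le_of_lt (by positivity) ht)

theorem profileIntegral_le_of_supercritical {α σ c a b : ℝ} (hα : -1 / 2 < α) (hc : 0 < c)
    (hσ : α + 1 < σ) :
    profileIntegral α σ c a b ≤ ENNReal.ofReal (Real.Gamma (σ - α - 1)) := by
  calc _ ≤ ∫⁻ t in Ioi (0 : ℝ), ENNReal.ofReal (t ^ (σ - α - 1 - 1) * Real.exp (-(1 * t))) := by
        refine setLIntegral_mono' measurableSet_Ioi fun t ht => ENNReal.ofReal_le_ofReal ?_
        refine (profile_le_large hα hc ht).trans (le_of_eq ?_)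
        rw [one_mul, mul_comm]
        congr 2
        ring
    _ = _ := by
        rw [lintegral_Ioi_exp_rpow (by linarith) one_pos]
        simp

/-- The part `t > b²` of the model integral, in the local estimates. -/
theorem exists_far_le {α σ : ℝ} (hσ : σ ≤ α + 1) :
    ∃ M : ℝ, 0 < M ∧ ∀ b : ℝ, 0 < b → b ≤ 1 →
      ∫⁻ t in Ioi (b ^ 2), ENNReal.ofReal (Real.exp (-t) * t ^ (σ - α - 2)) ≤
        ENNReal.ofReal M * ((if σ = α + 1 then elogRatio 1 b else 0) +
          epow b (2 * σ - 2 * α - 2)) := by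
  rcases hσ.eq_or_lt with h | h
  · refine ⟨2, two_pos, fun b hb hb1 => ?_⟩
    have hlog := Real.log_nonneg ((one_le_div hb).2 hb1)
    rw [if_pos h, elogRatio_of_le hb hb1, epow_of_pos hb, show 2 * σ - 2 * α - 2 = 0 by linarith,
      Real.rpow_zero, ← ENNReal.ofReal_add hlog zero_le_one, ← ENNReal.ofReal_mul two_pos.le]
    calc _ ≤ ∫⁻ t in Ioi (b ^ 2), ENNReal.ofReal (Real.exp (-(t / 2)) * t⁻¹) := by
          refine setLIntegral_mono' measurableSet_Ioi fun t ht => ENNReal.ofReal_le_ofReal ?_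
          have ht0 : 0 < t := lt_of_le_of_lt (by positivity) ht
          rw [show σ - α - 2 = -1 by linarith, Real.rpow_neg_one]
          gcongr
          linarith
      _ ≤ _ := lintegral_tail_le (by positivity)
      _ = _ := by
          have hb2 : b ^ 2 ≤ 1 := by nlinarith
          have : 1 ≤ 1 / b ^ 2 := (one_le_div (by positivity)).2 hb2
          rw [Real.posLog_eq_log (by rwa [abs_of_nonneg (by positivity)]),
            show 1 / b ^ 2 = (1 / b) ^ 2 by ring, Real.log_pow]
          push_cast
          congr 1
          ring
  · have hpos : 0 < α + 1 - σ := by linarith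
    refine ⟨(α + 1 - σ)⁻¹, by positivity, fun b hb hb1 => ?_⟩
    rw [if_neg h.ne, zero_add, epow_of_pos hb, ← ENNReal.ofReal_mul (by positivity)]
    calc _ ≤ ∫⁻ t in Ioi (b ^ 2), ENNReal.ofReal (t ^ (σ - α - 2)) := by
          refine setLIntegral_mono' measurableSet_Ioi fun t ht => ENNReal.ofReal_le_ofReal ?_
          have ht0 : 0 < t := lt_of_le_of_lt (by positivity) ht
          exact mul_le_of_le_one_left (by positivity) (Real.exp_le_one_iff.2 (by linarith))
      _ = _ := by
          rw [lintegral_Ioi_rpow (by linarith) (by positivity), sq_rpow hb.le,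
            show -(σ - α - 2 + 1) = α + 1 - σ by ring,
            show 2 * (σ - α - 2 + 1) = 2 * σ - 2 * α - 2 by ring]
          congr 1
          ring

/-- The part `t ≤ b²` of the model integral, in the local estimates. -/
theorem exists_small_le {α σ c : ℝ} (hσ : 0 < σ) (hc : 0 < c) :
    ∃ M : ℝ, 0 < M ∧ ∀ a b : ℝ, 0 ≤ a → a ≤ b → 0 < b →
      epow b (-2 * α - 1) *
        (∫⁻ t in Ioc 0 (b ^ 2), ENNReal.ofReal (Real.exp (-(c * a ^ 2 / t)) * t ^ (σ - 3 / 2))) ≤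
      ENNReal.ofReal M * (if σ < 1 / 2 then epow b (-2 * α - 1) * epow a (2 * σ - 1)
        else if σ = 1 / 2 then epow b (-2 * α - 1) * elogRatio (2 * b) a
        else epow b (2 * σ - 2 * α - 2)) := by
  have hbpos : ∀ b : ℝ, 0 < b → epow b (-2 * α - 1) ≠ 0 := fun b hb => by
    rw [epow_of_pos hb, Ne, ENNReal.ofReal_eq_zero, not_le]; positivity
  rcases lt_trichotomy σ (1 / 2) with h | h | h
  · obtain ⟨M, hM, hle⟩ := exists_lintegral_subcritical_le hc (s := σ - 3 / 2) (by linarith)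
      (by linarith)
    refine ⟨M, hM, fun a b ha hab hb => ?_⟩
    rw [if_pos h, mul_left_comm]
    refine mul_le_mul' le_rfl ?_
    rcases ha.eq_or_lt with rfl | ha0
    · rw [epow, ENNReal.ofReal_zero, ENNReal.zero_rpow_of_neg (by linarith),
        ENNReal.mul_top (by simpa using hM)]
      exact le_top
    · refine (lintegral_mono_set Ioc_subset_Ioi_self).trans ((hle a ha0).trans (le_of_eq ?_))
      congr 2
      ring
  · refine ⟨(c * Real.log 2)⁻¹ + 2, by have := Real.log_pos one_lt_two; positivity,
      fun a b ha hab hb => ?_⟩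
    have hlog2 := Real.log_pos one_lt_two
    rw [if_neg (by linarith), if_pos h, mul_left_comm]
    refine mul_le_mul' le_rfl ?_
    rcases ha.eq_or_lt with rfl | ha0
    · rw [elogRatio, if_pos rfl, ENNReal.mul_top (by simp; positivity)]
      exact le_top
    · rw [elogRatio_of_le ha0 (by linarith), ← ENNReal.ofReal_mul (by positivity),
        ← Ioc_union_Ioc_eq_Ioc (show (0 : ℝ) ≤ a ^ 2 by positivity)
          (show a ^ 2 ≤ b ^ 2 by gcongr)]
      have h2 : 2 * b / a = 2 * (b / a) := by ring
      have h3 : 1 ≤ b / a := (one_le_div ha0).2 hab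
      have hlogba := Real.log_nonneg h3
      have hlog : Real.log (2 * b / a) = Real.log 2 + Real.log (b / a) := by
        rw [h2, Real.log_mul two_ne_zero (by positivity)]
      calc _ ≤ ENNReal.ofReal c⁻¹ + ENNReal.ofReal (Real.log (b ^ 2 / a ^ 2)) := by
            refine (lintegral_union_le _ _ _).trans (add_le_add
              ((lintegral_near_le hc ha0 (by linarith)).trans (ENNReal.ofReal_le_ofReal ?_)) ?_)
            · rw [h]; norm_num
            · rw [← lintegral_Ioc_inv (by positivity) (by gcongr)]
              refine setLIntegral_mono' measurableSet_Ioc fun t ht => ENNReal.ofReal_le_ofReal ?_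
              have ht0 : 0 < t := lt_of_le_of_lt (by positivity) ht.1
              rw [h, show (1 : ℝ) / 2 - 3 / 2 = -1 by norm_num, Real.rpow_neg_one]
              exact mul_le_of_le_one_left (by positivity)
                (Real.exp_le_one_iff.2 (neg_nonpos.2 (by positivity)))
        _ ≤ _ := by
            have : 1 ≤ b ^ 2 / a ^ 2 := by rw [← div_pow]; exact one_le_pow₀ h3
            rw [← ENNReal.ofReal_add (by positivity) (Real.log_nonneg this)]
            refine ENNReal.ofReal_le_ofReal ?_
            rw [← div_pow, Real.log_pow, hlog]
            have e : (c * Real.log 2)⁻¹ * Real.log 2 = c⁻¹ := by field_simp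
            have : 0 ≤ (c * Real.log 2)⁻¹ * Real.log (b / a) := by positivity
            push_cast
            nlinarith
  · have hpos : 0 < σ - 1 / 2 := by linarith
    refine ⟨(σ - 1 / 2)⁻¹, by positivity, fun a b ha hab hb => ?_⟩
    rw [if_neg (by linarith), if_neg (by linarith), epow_of_pos hb, epow_of_pos hb,
      ← ENNReal.ofReal_mul (by positivity)]
    calc _ ≤ ENNReal.ofReal (b ^ (-2 * α - 1)) *
          ∫⁻ t in Ioc 0 (b ^ 2), ENNReal.ofReal (t ^ (σ - 3 / 2)) := by
          refine mul_le_mul' le_rfl (setLIntegral_mono' measurableSet_Ioc fun t ht =>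
            ENNReal.ofReal_le_ofReal ?_)
          have ht0 : 0 < t := ht.1
          exact mul_le_of_le_one_left (by positivity)
            (Real.exp_le_one_iff.2 (neg_nonpos.2 (by positivity)))
      _ = _ := by
          rw [lintegral_Ioc_rpow (by linarith) (by positivity),
            ← ENNReal.ofReal_mul (by positivity), sq_rpow hb.le]
          congr 1
          rw [show 2 * σ - 2 * α - 2 = (-2 * α - 1) + 2 * (σ - 3 / 2 + 1) by ring,
            Real.rpow_add hb, show σ - 3 / 2 + 1 = σ - 1 / 2 by ring]
          ring

/-- Absorbs the contribution of t > b² into the main term, using a ≤ b: a^{2σ-1} ≥ b^{2σ-1} for σ <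
1/2, and log(2b/a) ≥ log 2 for σ = 1/2. -/
theorem exists_epow_le_main {α σ : ℝ} :
    ∃ M : ℝ, 0 < M ∧ ∀ a b : ℝ, 0 ≤ a → a ≤ b → 0 < b →
      epow b (2 * σ - 2 * α - 2) ≤
      ENNReal.ofReal M * (if σ < 1 / 2 then epow b (-2 * α - 1) * epow a (2 * σ - 1)
        else if σ = 1 / 2 then epow b (-2 * α - 1) * elogRatio (2 * b) a
        else epow b (2 * σ - 2 * α - 2)) := by
  have hlog2 := Real.log_pos one_lt_two
  refine ⟨1 + (Real.log 2)⁻¹, by positivity, fun a b ha hab hb => ?_⟩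
  have hone : (1 : ℝ≥0∞) ≤ ENNReal.ofReal (1 + (Real.log 2)⁻¹) := by
    rw [← ENNReal.ofReal_one]
    exact ENNReal.ofReal_le_ofReal (by linarith [inv_pos.2 hlog2])
  have hsplit : epow b (2 * σ - 2 * α - 2) = epow b (-2 * α - 1) * epow b (2 * σ - 1) := by
    rw [epow_of_pos hb, epow_of_pos hb, epow_of_pos hb, ← ENNReal.ofReal_mul (by positivity),
      ← Real.rpow_add hb]
    congr 2
    ring
  split_ifs with h h'
  · refine le_mul_of_one_le_of_le hone ?_
    rw [hsplit]
    refine mul_le_mul' le_rfl ?_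
    rcases ha.eq_or_lt with rfl | ha0
    · rw [epow, epow, ENNReal.ofReal_zero, ENNReal.zero_rpow_of_neg (by linarith)]
      exact le_top
    · rw [epow_of_pos hb, epow_of_pos ha0]
      exact ENNReal.ofReal_le_ofReal (Real.rpow_le_rpow_of_nonpos ha0 hab (by linarith))
  · rw [hsplit, mul_left_comm]
    refine mul_le_mul' le_rfl ?_
    rcases ha.eq_or_lt with rfl | ha0
    · rw [elogRatio, if_pos rfl, ENNReal.mul_top (by simp; positivity)]
      exact le_top
    · rw [epow_of_pos hb, elogRatio_of_le ha0 (by linarith), ← ENNReal.ofReal_mul (by positivity)]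
      refine ENNReal.ofReal_le_ofReal ?_
      have h2 : Real.log 2 ≤ Real.log (2 * b / a) := by
        refine Real.log_le_log two_pos ?_
        rw [le_div_iff₀ ha0]
        linarith
      rw [h', show 2 * (1 / 2 : ℝ) - 1 = 0 by norm_num, Real.rpow_zero]
      calc (1 : ℝ) = (Real.log 2)⁻¹ * Real.log 2 := by field_simp
        _ ≤ (1 + (Real.log 2)⁻¹) * Real.log (2 * b / a) := by
          gcongr
          linarith
  · exact le_mul_of_one_le_of_le hone le_rfl

theorem exists_le_localBound {α σ c : ℝ} (hα : -1 / 2 < α) (hσ : 0 < σ) (hc : 0 < c) :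
    ∃ M : ℝ, 0 < M ∧ ∀ a b : ℝ, 0 ≤ a → a ≤ b → b ≤ 1 →
      profileIntegral α σ c a b ≤ ENNReal.ofReal M * localBound α σ a b := by
  rcases lt_or_ge (α + 1) σ with h | h
  · have hG := Real.Gamma_pos_of_pos (show 0 < σ - α - 1 by linarith)
    refine ⟨Real.Gamma (σ - α - 1), hG, fun a b ha hab hb => ?_⟩
    refine (profileIntegral_le_of_supercritical hα hc h).trans ?_
    have : 1 ≤ localBound α σ a b := by
      rw [localBound, if_pos h, add_assoc]
      exact le_self_add
    calc _ = ENNReal.ofReal (Real.Gamma (σ - α - 1)) * 1 := (mul_one _).symm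
      _ ≤ _ := by gcongr
  · obtain ⟨M₁, hM₁, h₁⟩ := exists_far_le h
    obtain ⟨M₂, hM₂, h₂⟩ := exists_small_le (α := α) hσ hc
    obtain ⟨M₃, hM₃, h₃⟩ := exists_epow_le_main (α := α) (σ := σ)
    refine ⟨M₁ + M₂ + M₁ * M₃, by positivity, fun a b ha hab hb => ?_⟩
    rcases (ha.trans hab).eq_or_lt with rfl | hb0
    -- Here b = 0 forces a = 0, and for σ ≤ α+1 the right-hand side is infinite at the origin, so
    -- the upper bound is trivial.
    · have : localBound α σ a 0 = ⊤ := by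
        obtain rfl : a = 0 := le_antisymm hab ha
        rw [localBound]
        rcases lt_trichotomy σ (1 / 2) with h' | h' | h'
        · simp only [if_pos h', epow, ENNReal.ofReal_zero]
          rw [ENNReal.zero_rpow_of_neg (by linarith), ENNReal.zero_rpow_of_neg (by linarith)]
          simp
        · have he : elogRatio (2 * 0) 0 = ⊤ := if_pos rfl
          rw [if_neg (show ¬ σ < 1 / 2 by linarith), if_pos h', he, epow,
            ENNReal.ofReal_zero, ENNReal.zero_rpow_of_neg (by linarith)]
          simp
        · rcases h.eq_or_lt with h4 | h4
          · simp [h4, elogRatio]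
          · rw [if_neg (show ¬ σ < 1 / 2 by linarith), if_neg h'.ne', epow,
              ENNReal.ofReal_zero, ENNReal.zero_rpow_of_neg (by linarith)]
            simp
      exact le_mul_of_eq_top (by positivity) this
    · refine (profileIntegral_le_add hα hc hb0).trans ((add_le_add (h₂ a b ha hab hb0)
        (h₁ b hb0 hb)).trans ?_)
      rw [localBound, if_neg h.not_gt, zero_add]
      have h₃' := h₃ a b ha hab hb0
      generalize (if σ = α + 1 then elogRatio 1 b else 0) = L
      revert h₃'
      generalize (if σ < 1 / 2 then epow b (-2 * α - 1) * epow a (2 * σ - 1)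
        else if σ = 1 / 2 then epow b (-2 * α - 1) * elogRatio (2 * b) a
        else epow b (2 * σ - 2 * α - 2)) = R
      intro h₃'
      calc _ ≤ ENNReal.ofReal M₂ * R + ENNReal.ofReal M₁ * (L + ENNReal.ofReal M₃ * R) := by gcongr
        _ = ENNReal.ofReal M₁ * L + (ENNReal.ofReal M₂ + ENNReal.ofReal (M₁ * M₃)) * R := by
          rw [ENNReal.ofReal_mul hM₁.le]; ring
        _ ≤ ENNReal.ofReal (M₁ + M₂ + M₁ * M₃) * L + ENNReal.ofReal (M₁ + M₂ + M₁ * M₃) * R := by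
          rw [← ENNReal.ofReal_add hM₂.le (by positivity)]
          have h5 : 0 ≤ M₁ * M₃ := by positivity
          gcongr
          · linarith
          · linarith
        _ = _ := by ring

theorem exists_le_globalBound {α σ c : ℝ} (hα : -1 / 2 < α) (hσ : 0 < σ) (hc : 0 < c) :
    ∃ M : ℝ, 0 < M ∧ ∀ a b : ℝ, 0 ≤ a → 1 < b →
      profileIntegral α σ c a b ≤
        ENNReal.ofReal M * (globalBound α σ a b * ENNReal.ofReal (Real.exp (-√c * a))) := by
  -- Half of the exponent gives the decay: (t + ca²/t)/2 ≥ √c·a by completing the square. The other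
  -- half, with c/2 in the Gaussian, remains to make the integral converge.
  suffices hkey : ∃ M : ℝ, 0 < M ∧ ∀ a : ℝ, 0 ≤ a →
      ∫⁻ t in Ioi 0, ENNReal.ofReal (Real.exp (-(t / 2)) *
        (Real.exp (-(c / 2 * a ^ 2 / t)) * t ^ (σ - 3 / 2))) ≤ ENNReal.ofReal M *
      (if σ < 1 / 2 then epow a (2 * σ - 1) else if σ = 1 / 2 then 1 + elogRatio 1 a else 1) by
    obtain ⟨M, hM, hle⟩ := hkey
    refine ⟨M, hM, fun a b ha hb => ?_⟩
    have hb0 : 0 < b := by linarith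
    calc _ ≤ ∫⁻ t in Ioi 0, ENNReal.ofReal (b ^ (-2 * α - 1) * Real.exp (-√c * a)) *
          ENNReal.ofReal (Real.exp (-(t / 2)) *
            (Real.exp (-(c / 2 * a ^ 2 / t)) * t ^ (σ - 3 / 2))) := by
          refine setLIntegral_mono' measurableSet_Ioi fun t ht => ?_
          have ht0 : 0 < t := ht
          rw [← ENNReal.ofReal_mul (by positivity)]
          refine ENNReal.ofReal_le_ofReal ((profile_le_small hα ht0 hb0).trans ?_)
          have e : Real.exp (-t) * Real.exp (-(c * a ^ 2 / t)) ≤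
              Real.exp (-√c * a) * (Real.exp (-(t / 2)) * Real.exp (-(c / 2 * a ^ 2 / t))) := by
            rw [← Real.exp_add, ← Real.exp_add, ← Real.exp_add]
            refine Real.exp_le_exp.2 ?_
            have h1 : 0 ≤ (t - √c * a) ^ 2 / t := by positivity
            have h2 : (t - √c * a) ^ 2 / t = t - 2 * (√c * a) + c * a ^ 2 / t := by
              field_simp
              linear_combination a ^ 2 * Real.sq_sqrt hc.le
            have h3 : c / 2 * a ^ 2 / t = c * a ^ 2 / t / 2 := by ring
            rw [h3]
            linarith
          calc _ = b ^ (-2 * α - 1) * (Real.exp (-t) * Real.exp (-(c * a ^ 2 / t))) *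
                t ^ (σ - 3 / 2) := by ring
            _ ≤ b ^ (-2 * α - 1) * (Real.exp (-√c * a) *
                (Real.exp (-(t / 2)) * Real.exp (-(c / 2 * a ^ 2 / t)))) * t ^ (σ - 3 / 2) := by
              gcongr
            _ = _ := by ring
      _ ≤ ENNReal.ofReal (b ^ (-2 * α - 1) * Real.exp (-√c * a)) * (ENNReal.ofReal M * _) := by
          rw [lintegral_const_mul' _ _ ENNReal.ofReal_ne_top]
          exact mul_le_mul' le_rfl (hle a ha)
      _ = _ := by
          rw [globalBound, ENNReal.ofReal_mul (by positivity), epow_of_pos hb0]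
          ring
  have hexp1 : ∀ t : ℝ, 0 < t → Real.exp (-(t / 2)) ≤ 1 := fun t ht =>
    Real.exp_le_one_iff.2 (by linarith)
  have hexp2 : ∀ a t : ℝ, 0 < t → Real.exp (-(c / 2 * a ^ 2 / t)) ≤ 1 := fun a t ht =>
    Real.exp_le_one_iff.2 (neg_nonpos.2 (by positivity))
  rcases lt_trichotomy σ (1 / 2) with h | h | h
  · obtain ⟨M, hM, hle⟩ := exists_lintegral_subcritical_le (half_pos hc) (s := σ - 3 / 2)
      (by linarith) (by linarith)
    refine ⟨M, hM, fun a ha => ?_⟩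
    rw [if_pos h]
    rcases ha.eq_or_lt with rfl | ha0
    · rw [epow, ENNReal.ofReal_zero, ENNReal.zero_rpow_of_neg (by linarith),
        ENNReal.mul_top (by simpa using hM)]
      exact le_top
    · rw [show 2 * σ - 1 = 2 * (σ - 3 / 2) + 2 by ring]
      refine le_trans ?_ (hle a ha0)
      refine setLIntegral_mono' measurableSet_Ioi fun t ht => ENNReal.ofReal_le_ofReal ?_
      have ht0 : 0 < t := ht
      exact mul_le_of_le_one_left (by positivity) (hexp1 t ht0)
  -- The near part contributes 2/c, since the Gaussian constant is now c/2, and the tail contributes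
  -- 2 log⁺(1/a) + 2.
  · refine ⟨2 / c + 2, by positivity, fun a ha => ?_⟩
    rw [if_neg (by linarith), if_pos h]
    rcases ha.eq_or_lt with rfl | ha0
    · rw [elogRatio, if_pos rfl, add_top, ENNReal.mul_top (by simp; positivity)]
      exact le_top
    · rw [elogRatio, if_neg ha0.ne', ← ENNReal.ofReal_one,
        ← ENNReal.ofReal_add zero_le_one Real.posLog_nonneg, ← ENNReal.ofReal_mul (by positivity),
        ← Ioc_union_Ioi_eq_Ioi (show (0 : ℝ) ≤ a ^ 2 by positivity)]
      have hlog : Real.posLog (1 / a ^ 2) = 2 * Real.posLog (1 / a) := by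
        change max 0 (Real.log (1 / a ^ 2)) = 2 * max 0 (Real.log (1 / a))
        rw [show 1 / a ^ 2 = (1 / a) ^ 2 by ring, Real.log_pow, mul_max_of_nonneg _ _ two_pos.le]
        simp
      have hnn : 0 ≤ Real.posLog (1 / a) := Real.posLog_nonneg
      calc _ ≤ ENNReal.ofReal (2 / c) + ENNReal.ofReal (Real.posLog (1 / a ^ 2) + 2) := by
            refine (lintegral_union_le _ _ _).trans (add_le_add ?_
              (le_trans ?_ (lintegral_tail_le (by positivity))))
            · refine le_trans ?_ ((lintegral_near_le (half_pos hc) ha0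
                (show -2 < σ - 3 / 2 by linarith)).trans (ENNReal.ofReal_le_ofReal ?_))
              · refine setLIntegral_mono' measurableSet_Ioc fun t ht => ENNReal.ofReal_le_ofReal ?_
                have ht0 : 0 < t := ht.1
                exact mul_le_of_le_one_left (by positivity) (hexp1 t ht0)
              · rw [h]; norm_num
            · refine setLIntegral_mono' measurableSet_Ioi fun t ht => ENNReal.ofReal_le_ofReal ?_
              have ht0 : 0 < t := lt_of_le_of_lt (by positivity) ht
              rw [h, show (1 : ℝ) / 2 - 3 / 2 = -1 by norm_num, Real.rpow_neg_one]
              gcongr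
              exact mul_le_of_le_one_left (by positivity) (hexp2 a t ht0)
        _ ≤ _ := by
            rw [← ENNReal.ofReal_add (by positivity)
              (add_nonneg Real.posLog_nonneg two_pos.le), hlog]
            refine ENNReal.ofReal_le_ofReal ?_
            have : 0 ≤ 2 / c * Real.posLog (1 / a) := by positivity
            nlinarith
  · have hG := Real.Gamma_pos_of_pos (show 0 < σ - 1 / 2 by linarith)
    refine ⟨2 ^ (σ - 1 / 2) * Real.Gamma (σ - 1 / 2), by positivity, fun a ha => ?_⟩
    rw [if_neg (by linarith), if_neg (by linarith), mul_one]
    calc _ ≤ ∫⁻ t in Ioi (0 : ℝ),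
          ENNReal.ofReal (t ^ (σ - 1 / 2 - 1) * Real.exp (-(1 / 2 * t))) := by
          refine setLIntegral_mono' measurableSet_Ioi fun t ht => ENNReal.ofReal_le_ofReal ?_
          have ht0 : 0 < t := ht
          rw [show σ - 1 / 2 - 1 = σ - 3 / 2 by ring, show 1 / 2 * t = t / 2 by ring,
            mul_comm (t ^ (σ - 3 / 2))]
          refine mul_le_mul_of_nonneg_left ?_ (Real.exp_nonneg _)
          exact mul_le_of_le_one_left (by positivity) (hexp2 a t ht0)
      _ = _ := by
          rw [lintegral_Ioi_exp_rpow (by linarith) (by norm_num)]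
          norm_num

/-! ### Assembly of the estimates. -/

theorem lower_sandwich {m K C : ℝ} {X : EReal} {Y I : ℝ≥0∞} (hm : 0 < m) (hK : 0 < K)
    (hC : K / m ≤ C) (hX : ((ENNReal.ofReal m * I : ℝ≥0∞) : EReal) ≤ X)
    (hI : Y ≤ ENNReal.ofReal K * I) : ((ENNReal.ofReal C⁻¹ * Y : ℝ≥0∞) : EReal) ≤ X := by
  refine le_trans ?_ hX
  rw [EReal.coe_ennreal_le_coe_ennreal_iff]
  calc _ ≤ ENNReal.ofReal (K / m)⁻¹ * (ENNReal.ofReal K * I) := by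
        refine mul_le_mul' (ENNReal.ofReal_le_ofReal ?_) hI
        gcongr
    _ = _ := by
        rw [← mul_assoc, ← ENNReal.ofReal_mul (by positivity)]
        congr 2
        field_simp

theorem upper_sandwich {M L C : ℝ} {X : EReal} {Y I : ℝ≥0∞} (hM : 0 < M)
    (hC : M * L ≤ C) (hX : X ≤ ((ENNReal.ofReal M * I : ℝ≥0∞) : EReal))
    (hI : I ≤ ENNReal.ofReal L * Y) : X ≤ ((ENNReal.ofReal C * Y : ℝ≥0∞) : EReal) := by
  refine hX.trans ?_
  rw [EReal.coe_ennreal_le_coe_ennreal_iff]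
  calc _ ≤ ENNReal.ofReal M * (ENNReal.ofReal L * Y) := mul_le_mul' le_rfl hI
    _ = ENNReal.ofReal (M * L) * Y := by rw [← mul_assoc, ← ENNReal.ofReal_mul hM.le]
    _ ≤ _ := by gcongr

/-- The local estimate of a kernel that is sandwiched between model integrals. -/
theorem comparable_localBound {α σ : ℝ} (hα : -1 / 2 < α) (hσ : 0 < σ) {S : Set (ℝ × ℝ)}
    {X : ℝ → ℝ → EReal} {a b : ℝ → ℝ → ℝ}
    (hX : ∃ m M : ℝ, 0 < m ∧ 0 < M ∧ ∀ x y, (x, y) ∈ S →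
      ((ENNReal.ofReal m * profileIntegral α σ (1 / 4) (a x y) (b x y) : ℝ≥0∞) : EReal) ≤ X x y ∧
      X x y ≤ ((ENNReal.ofReal M * profileIntegral α σ (1 / 8) (a x y) (b x y) : ℝ≥0∞) : EReal))
    (hab : ∀ x y, (x, y) ∈ S → 0 ≤ a x y ∧ a x y ≤ b x y ∧ b x y ≤ 1) :
    Comparable S X fun x y => localBound α σ (a x y) (b x y) := by
  obtain ⟨m, M, hm, hM, hX⟩ := hX
  obtain ⟨K, hK, hI⟩ := exists_localBound_le (σ := σ) hα (c := 1 / 4) (by norm_num)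
  obtain ⟨L, hL, hJ⟩ := exists_le_localBound hα hσ (c := 1 / 8) (by norm_num)
  have h1 : 0 < K / m := by positivity
  have h2 : 0 < M * L := by positivity
  -- The sum dominates both the constant K/m of the lower bound and ML of the upper bound, so one C
  -- serves both.
  refine ⟨K / m + M * L, by positivity, fun x y hxy => ?_⟩
  obtain ⟨h3, h4, h5⟩ := hab x y hxy
  exact ⟨lower_sandwich hm hK (by linarith) (hX x y hxy).1 (hI _ _ h3 h4 h5),
    upper_sandwich hM (by linarith) (hX x y hxy).2 (hJ _ _ h3 h4 h5)⟩

/-- The global estimate of a kernel that is sandwiched between model integrals. -/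
theorem expComparable_globalBound {α σ : ℝ} (hα : -1 / 2 < α) (hσ : 0 < σ) {S : Set (ℝ × ℝ)}
    {X : ℝ → ℝ → EReal} {a b : ℝ → ℝ → ℝ}
    (hX : ∃ m M : ℝ, 0 < m ∧ 0 < M ∧ ∀ x y, (x, y) ∈ S →
      ((ENNReal.ofReal m * profileIntegral α σ (1 / 4) (a x y) (b x y) : ℝ≥0∞) : EReal) ≤ X x y ∧
      X x y ≤ ((ENNReal.ofReal M * profileIntegral α σ (1 / 8) (a x y) (b x y) : ℝ≥0∞) : EReal))
    (hab : ∀ x y, (x, y) ∈ S → 0 ≤ a x y ∧ a x y ≤ b x y ∧ 1 < b x y) :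
    ExpComparable S X (fun x y => globalBound α σ (a x y) (b x y)) a := by
  obtain ⟨m, M, hm, hM, hX⟩ := hX
  obtain ⟨K, hK, hI⟩ := exists_globalBound_le hα hσ (c := 1 / 4) (by norm_num)
  obtain ⟨L, hL, hJ⟩ := exists_le_globalBound hα hσ (c := 1 / 8) (by norm_num)
  have h1 : 0 < K / m := by positivity
  have h2 : 0 < M * L := by positivity
  refine ⟨K / m + M * L, 3 + 1 / 4, √(1 / 8), by positivity, by norm_num, by positivity,
    fun x y hxy => ?_⟩
  obtain ⟨h3, h4, h5⟩ := hab x y hxy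
  exact ⟨lower_sandwich hm hK (by linarith) (hX x y hxy).1 (hI _ _ h3 h4 h5),
    upper_sandwich hM (by linarith) (hX x y hxy).2 (hJ _ _ h3 h5)⟩

/-- Since σ + 1 > 1/2, only the last case survives, and both 2σ - 2α - 2 and the comparison of σ
with α + 1 are unaffected by the simultaneous shift. -/
theorem localBound_succ {α σ a b : ℝ} (hσ : 0 < σ) : localBound (α + 1) (σ + 1) a b =
    ((if α + 1 < σ then 1 else 0) + (if σ = α + 1 then elogRatio 1 b else 0)) +
      epow b (2 * σ - 2 * α - 2) := by
  rw [localBound, if_neg (show ¬ σ + 1 < 1 / 2 by linarith),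
    if_neg (show ¬ σ + 1 = 1 / 2 by linarith),
    show 2 * (σ + 1) - 2 * (α + 1) - 2 = 2 * σ - 2 * α - 2 by ring]
  simp only [add_lt_add_iff_right, add_left_inj]

/-- The shift of α alone is visible here: -2(α+1) - 1 = (-2α-1) - 2 is the source of the factor
b^{-2}. -/
theorem globalBound_succ {α σ a b : ℝ} (hσ : 0 < σ) (hb : 0 < b) :
    globalBound (α + 1) (σ + 1) a b = epow b (-2 * α - 1) * epow b (-2) := by
  rw [globalBound, if_neg (show ¬ σ + 1 < 1 / 2 by linarith),
    if_neg (show ¬ σ + 1 = 1 / 2 by linarith), mul_one, epow_of_pos hb, epow_of_pos hb,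
    epow_of_pos hb, ← ENNReal.ofReal_mul (by positivity), ← Real.rpow_add hb]
  congr 2
  ring

end HankelDunkl

theorem theorem2p19 (α σ : ℝ) (hα : -1 / 2 < α) (hσ : 0 < σ) :
    -- arguments of the same sign, local estimate
    HankelDunkl.Comparable {p : ℝ × ℝ | 0 ≤ p.1 * p.2 ∧ |p.1| + |p.2| ≤ 1}
      (HankelDunkl.besselKernel α σ)
      (fun x y => HankelDunkl.localCommon α σ x y + HankelDunkl.sameSignLocal α σ x y) ∧
    -- arguments of the same sign, global estimate
    HankelDunkl.ExpComparable {p : ℝ × ℝ | 0 ≤ p.1 * p.2 ∧ 1 < |p.1| + |p.2|}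
      (HankelDunkl.besselKernel α σ)
      (HankelDunkl.sameSignGlobal α σ)
      (fun x y => |x - y|) ∧
    -- arguments of opposite signs, local estimate
    HankelDunkl.Comparable {p : ℝ × ℝ | p.1 * p.2 < 0 ∧ |p.1| + |p.2| ≤ 1}
      (HankelDunkl.besselKernel α σ)
      (fun x y => HankelDunkl.localCommon α σ x y +
        HankelDunkl.epow (|x| + |y|) (2 * σ - 2 * α - 2)) ∧
    -- arguments of opposite signs, global estimate
    HankelDunkl.ExpComparable {p : ℝ × ℝ | p.1 * p.2 < 0 ∧ 1 < |p.1| + |p.2|}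
      (HankelDunkl.besselKernel α σ)
      (fun x y => HankelDunkl.epow (|x| + |y|) (-2 * α - 1) *
        HankelDunkl.epow (|x| + |y|) (-2))
      (fun x y => |x + y|) := by
  have hα' : -1 / 2 < α + 1 := by linarith
  have hσ' : 0 < σ + 1 := by linarith
  obtain ⟨m, M, hm, hM, hs⟩ := HankelDunkl.besselKernel_same_sign hα hσ
  obtain ⟨m', M', hm', hM', ho⟩ := HankelDunkl.besselKernel_opposite_sign hα hσ
  refine ⟨?_, ?_, ?_, ?_⟩
  -- With a = |x-y| and b = |x|+|y|, `localBound` unfolds to the stated right-hand side.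
  · exact HankelDunkl.comparable_localBound hα hσ ⟨m, M, hm, hM, fun x y h => hs x y h.1⟩
      fun x y h => ⟨abs_nonneg _, abs_sub x y, h.2⟩
  · exact HankelDunkl.expComparable_globalBound hα hσ ⟨m, M, hm, hM, fun x y h => hs x y h.1⟩
      fun x y h => ⟨abs_nonneg _, abs_sub x y, h.2⟩
  · have h := HankelDunkl.comparable_localBound hα' hσ'
      (S := {p : ℝ × ℝ | p.1 * p.2 < 0 ∧ |p.1| + |p.2| ≤ 1})
      (a := fun x y => |x + y|) (b := fun x y => |x| + |y|)
      ⟨m', M', hm', hM', fun x y h => ho x y h.1⟩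
      fun x y h => ⟨abs_nonneg _, abs_add_le x y, h.2⟩
    simp only [HankelDunkl.localBound_succ hσ] at h
    exact h
  · obtain ⟨C, c₁, c₂, hC, hc₁, hc₂, h⟩ := HankelDunkl.expComparable_globalBound hα' hσ'
      (S := {p : ℝ × ℝ | p.1 * p.2 < 0 ∧ 1 < |p.1| + |p.2|})
      (a := fun x y => |x + y|) (b := fun x y => |x| + |y|)
      ⟨m', M', hm', hM', fun x y h => ho x y h.1⟩
      fun x y h => ⟨abs_nonneg _, abs_add_le x y, h.2⟩
    refine ⟨C, c₁, c₂, hC, hc₁, hc₂, fun x y hxy => ?_⟩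
    have hxy' := h x y hxy
    simp only at hxy'
    rwa [HankelDunkl.globalBound_succ hσ (lt_trans one_pos hxy.2)] at hxy'
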